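/- Let $I\subset\mathbb R$ be a nondegenerate time interval, $\nu_1,\nu_2>0$, $\chi_1,\chi_2\in\{0,1\}$, let $h:I\to(0,\infty)$ be differentiable, and put $k_j(t)=h(t)^2/(12\nu_j)$. For $t\in I$ let $\Omega_2(t)\subset\mathbb R^2$ be a bounded simply connected domain with boundary $\Gamma(t)$, and let $\Omega_1(t)=\mathbb R^2\setminus\overline{\Omega_2(t)}$. Here $\Omega_2(t)=\{g(\cdot,t)<0\}$ and $\Gamma(t)=\{g(\cdot,t)=0\}$, where $g$ is $C^1$ on $\mathbb R^2\times I$ and $\nabla g\neq0$ on $\Gamma(t)$; thus $n=\nabla g/|\nabla g|$ is the unit normal pointing out of $\Omega_2(t)$ and $v_n=-\partial_t g/|\nabla g|$ is the normal velocity of $\Gamma(t)$. Suppose that this is a solution of the two-phase Hele-Shaw (Muskat) problem with gap width $h$, with sinks and sources of density $\mu_j(\cdot,t)$ supported by $\gamma_j(t)\subset\Omega_j(t)$, and with a pressure on the interface that depends on time only. That is, there are pressures $p_j(\cdot,t)$, locally integrable in $\Omega_j(t)$ and $C^1$ up to $\Gamma(t)$ near $\Gamma(t)$, with $$\Delta p_j=\frac1{k_j}\frac{\dot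 h}{h}+\chi_j\mu_j\ \text{ in }\Omega_j(t)\text{ in the sense of distributions},$$ $$p_1=p_2=f(t)\ \text{ on }\Gamma(t),\qquad -k_1\frac{\partial p_1}{\partial n}=-k_2\frac{\partial p_2}{\partial n}=v_n\ \text{ on }\Gamma(t),$$ for some function $f$ of time (for instance $f=0$). Here $\gamma_2(t)$ is the union of a compact set of finite length (curves), on which $\mu_2$ is an integrable density with respect to arc length, and of finitely many points, at which $\mu_2$ is a point mass; $\int_{\gamma_2}u\,\mu_2\,ds$ is the corresponding integral plus the sum over the points. The support $\gamma_1(t)$ is of the same kind, except that its curves need not be bounded: they form a closed set, each bounded part of which has finite length and an integrable density. Then the following hold. 1. (Moment dynamics.) For every $t\in I$ and every function $u=u(x,y)$ that is harmonic in an open set containing $\overline{\Omega_2(t)}$, both integrals below converge and $$\frac{d}{dt}\Bigl[h(t)\int_{\Omega_2(t)}u\,dx\,dy\Bigr]=-\chi_2\,k_2(t)\,h(t)\int_{\gamma_2(t)}u\,\mu_2\,ds$$ (a one-sided derivative at an end point of $I$). 2. If $\chi_2=0$, then $h(t)\int_{\Omega_2(t)}u\,dx\,dy$ is constant on $I$ for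 every $u$ that is harmonic in an open set containing $\overline{\Omega_2(t)}$ for all $t\in I$. 3. Let $A(t)$ be the area of $\Omega_2(t)$. The choice $u\equiv1$ gives $\frac{d}{dt}[A(t)h(t)]=-\chi_2k_2(t)h(t)\int_{\gamma_2(t)}\mu_2\,ds$ for $t\in I$. Hence for $\chi_2=0$ the volume $A(t)h(t)$ is constant on $I$, and for $\chi_2=1$ it is constant on $I$ if and only if $\int_{\gamma_2(t)}\mu_2\,ds=0$ for all $t\in I$. -/

import Mathlib

open MeasureTheory InnerProductSpace
open scoped ContDiff Laplacian

namespace HeleShaw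

noncomputable section

/-- The plane `ℝ²` with its Euclidean structure. -/
abbrev Plane := EuclideanSpace ℝ (Fin 2)

/-! ### The moving interface

The interface at time `t` is a curve `{g(·, t) = 0}`, the bounded fluid occupies `{g(·, t) < 0}`
and the other fluid the rest of the plane. -/

/-- The domain `Ω₂(t)` of the inner fluid. -/
def inner2 (g : ℝ → Plane → ℝ) (t : ℝ) : Set Plane := {x | g t x < 0}

/-- The interface `Γ(t)`. -/
def interface (g : ℝ → Plane → ℝ) (t : ℝ) : Set Plane := {x | g t x = 0}

/-- The domain `Ω₁(t) = ℝ² \ closure Ω₂(t)` of the outer fluid. -/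
def outer1 (g : ℝ → Plane → ℝ) (t : ℝ) : Set Plane := (closure (inner2 g t))ᶜ

/-- The unit normal `∇g / |∇g|` of `Γ(t)`; it points out of `Ω₂(t)`. -/
def normal (g : ℝ → Plane → ℝ) (t : ℝ) (x : Plane) : Plane :=
  ‖gradient (g t) x‖⁻¹ • gradient (g t) x

/-- The normal velocity `v_n = -∂ₜg / |∇g|` of `Γ(t)`. The time derivative is taken within the
time interval `I`, so it is one-sided at an end point of `I`. -/
def normalVelocity (I : Set ℝ) (g : ℝ → Plane → ℝ) (t : ℝ) (x : Plane) : ℝ :=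
  -derivWithin (fun s => g s x) I t / ‖gradient (g t) x‖

/-- `g` describes, for `t ∈ I`, a bounded simply connected domain `Ω₂(t)` whose boundary is a
regular curve `Γ(t)` that moves in a continuously differentiable way. -/
structure IsMovingDomain (I : Set ℝ) (g : ℝ → Plane → ℝ) : Prop where
  contDiffOn : ContDiffOn ℝ 1 (fun q : ℝ × Plane => g q.1 q.2) (I ×ˢ Set.univ)
  gradient_ne_zero : ∀ t ∈ I, ∀ x ∈ interface g t, gradient (g t) x ≠ 0
  isBounded : ∀ t ∈ I, Bornology.IsBounded (inner2 g t)
  isSimplyConnected : ∀ t ∈ I, IsSimplyConnected (inner2 g t)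

/-! ### Sinks and sources -/

/-- A distribution of sinks and sources, supported by curves and points: a set `cut` (the curves)
with a density with respect to arc length, and finitely many points with strengths. -/
structure Sources where
  cut : Set Plane
  density : Plane → ℝ
  points : Finset Plane
  strength : Plane → ℝ

/-- The support `γ`. -/
def Sources.support (S : Sources) : Set Plane := S.cut ∪ ↑S.points

/-- `∫_γ u μ ds`: arc length (one-dimensional Hausdorff measure) on the curves, and a sum over the
point sources. -/
def Sources.integral (S : Sources) (u : Plane → ℝ) : ℝ :=
  (∫ x in S.cut, u x * S.density x ∂μH[1]) + ∑ a ∈ S.points, u a * S.strength a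

/-- The sources lie in `D`; their curves are closed in the plane, and every bounded part of
them has finite length and finite total flux. If `D` is bounded, the curves thus form a compact
subset of `D`, of finite length, with an integrable density. -/
structure Sources.LieIn (S : Sources) (D : Set Plane) : Prop where
  isClosed_cut : IsClosed S.cut
  support_subset : S.support ⊆ D
  length_lt_top : ∀ K : Set Plane, IsCompact K → μH[1] (S.cut ∩ K) < ⊤
  integrableOn : ∀ K : Set Plane, IsCompact K → IntegrableOn S.density (S.cut ∩ K) μH[1]

/-! ### The two-phase problem -/

/-- `p` solves `Δ p = c + χ μ` in the open set `D` in the sense of distributions, where `μ` is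
the distribution given by the sources `S`, and `p` is continuously differentiable up to the
boundary of `D` near that boundary. -/
structure IsPressure (D : Set Plane) (c χ : ℝ) (S : Sources) (p : Plane → ℝ) : Prop where
  locallyIntegrableOn : LocallyIntegrableOn p D
  poisson : ∀ φ : Plane → ℝ, ContDiff ℝ ∞ φ → HasCompactSupport φ → tsupport φ ⊆ D →
    ∫ x in D, p x * (Δ φ) x = c * (∫ x in D, φ x) + χ * S.integral φ
  contDiffOn_boundary : ∃ N : Set Plane, IsOpen N ∧ frontier D ⊆ N ∧
    ContDiffOn ℝ 1 p (closure D ∩ N)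

/-- The derivative at a boundary point `x` of `D`, in the direction `n`, of a function `p` that
is differentiable up to the boundary of `D`; the values of `p` outside `closure D` are
irrelevant. -/
def boundaryDeriv (D : Set Plane) (p : Plane → ℝ) (x n : Plane) : ℝ :=
  fderivWithin ℝ p (closure D) x n

/-- The coefficient `k(t) = h(t)² / (12 ν)` in Darcy's law. -/
def mobility (ν : ℝ) (h : ℝ → ℝ) (t : ℝ) : ℝ := h t ^ 2 / (12 * ν)

/-- A solution, on the time interval `I`, of the two-phase Hele-Shaw (Muskat) problem with gap
width `h(t)`, viscosities `ν₁`, `ν₂`, and sinks and sources `S₁`, `S₂` that are present in the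
phase `j` if `χⱼ = 1` and absent if `χⱼ = 0`, such that the pressure on the interface is a
function `f` of time only. -/
structure IsMuskatSolution (I : Set ℝ) (ν₁ ν₂ χ₁ χ₂ : ℝ) (h : ℝ → ℝ) (S₁ S₂ : ℝ → Sources)
    (g p₁ p₂ : ℝ → Plane → ℝ) (f : ℝ → ℝ) : Prop where
  viscosity₁_pos : 0 < ν₁
  viscosity₂_pos : 0 < ν₂
  chi₁ : χ₁ = 0 ∨ χ₁ = 1
  chi₂ : χ₂ = 0 ∨ χ₂ = 1
  gap_pos : ∀ t ∈ I, 0 < h t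
  gap_differentiable : DifferentiableOn ℝ h I
  movingDomain : IsMovingDomain I g
  sources₁ : ∀ t ∈ I, (S₁ t).LieIn (outer1 g t)
  sources₂ : ∀ t ∈ I, (S₂ t).LieIn (inner2 g t)
  /-- `Δ p₁ = ḣ / (k₁ h) + χ₁ μ₁` in `Ω₁(t)` -/
  pressure₁ : ∀ t ∈ I, IsPressure (outer1 g t)
    (1 / mobility ν₁ h t * (derivWithin h I t / h t)) χ₁ (S₁ t) (p₁ t)
  /-- `Δ p₂ = ḣ / (k₂ h) + χ₂ μ₂` in `Ω₂(t)` -/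
  pressure₂ : ∀ t ∈ I, IsPressure (inner2 g t)
    (1 / mobility ν₂ h t * (derivWithin h I t / h t)) χ₂ (S₂ t) (p₂ t)
  /-- continuity of the pressure across `Γ(t)` -/
  pressure_eq : ∀ t ∈ I, ∀ x ∈ interface g t, p₁ t x = p₂ t x
  /-- the common value is a function of time only -/
  pressure_interface : ∀ t ∈ I, ∀ x ∈ interface g t, p₂ t x = f t
  /-- `-k₁ ∂p₁/∂n = v_n` on `Γ(t)` -/
  kinematic₁ : ∀ t ∈ I, ∀ x ∈ interface g t,
    -mobility ν₁ h t * boundaryDeriv (outer1 g t) (p₁ t) x (normal g t x) = normalVelocity I g t x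
  /-- `-k₂ ∂p₂/∂n = v_n` on `Γ(t)` -/
  kinematic₂ : ∀ t ∈ I, ∀ x ∈ interface g t,
    -mobility ν₂ h t * boundaryDeriv (inner2 g t) (p₂ t) x (normal g t x) = normalVelocity I g t x

end

end HeleShaw

/-! Classically the proof takes three lines. Reynolds' transport theorem gives `d/dt ∫_{Ω₂} u = ∫_Γ
u v_n ds`, and Darcy's law replaces `v_n` by `-k₂ ∂p₂/∂n`. Put `q = p₂ - f(t)`. It vanishes on `Γ`
and `u` is harmonic, so Green's identity turns `∫_Γ u ∂q/∂n ds` into `∫ u Δq = (ḣ/(k₂h)) ∫ u + χ₂ ∫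
u μ₂`. Hence `d/dt ∫ u = -(ḣ/h) ∫ u - χ₂ k₂ ∫ u μ₂`, and the product rule for `h ∫ u` cancels the
term with `ḣ`.

The interface is only `C¹` and the pressure equation only distributional, so integrals over `Γ` are
avoided altogether. The indicator of `{g < 0}` is replaced by a cutoff `β_ε(g)` with `β_ε = stepDown
ε`, whose gradient lives in the thin layer `-2ε ≤ g ≤ -ε`. The curve integral is replaced by `∫_{Ω₂}
div Y`, where `Y` is a `C¹` field with `∇g · Y ≈ -u ∂ₜg` on `Γ`, that is, `Y · n ≈ u v_n`
(`exists_field_with_flux`). Errors are measured against a second field `X` with `∇g · X > 1` on `Γ`: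
an error `η` in the flux density costs at most `η ∫ |div X|`, uniformly in `ε`
(`abs_integral_deriv_stepDown_sub_le`). So `∫ |div X|` plays the part of the length of `Γ`.

Two estimates share the middle term `∫ div Y`. `abs_flux_sub_integral_divergence_le` compares it
with the value predicted by Green's identity (`integral_greenFlux`), and
`eventually_abs_integral_sub_le` with the difference quotient of `∫_{Ω₂} u`. As `η` is arbitrary,
`hasDerivWithinAt_integral` follows. Connectedness of `Ω₂(s)` enters through
`eventually_inner2_subset`: it prevents pieces of the domain from appearing far away. -/

namespace HeleShaw

open Set Filter Topology

/-! ### Divergence and integration by parts -/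

/-- The `i`-th coordinate direction of the plane. -/
noncomputable abbrev coord (i : Fin 2) : Plane := EuclideanSpace.single i 1

lemma sum_smul_coord (v : Plane) : ∑ i, v i • coord i = v := by
  ext j
  fin_cases j <;> simp [Fin.sum_univ_two]

lemma map_eq_sum_coord (L : Plane →L[ℝ] ℝ) (v : Plane) : L v = ∑ i, v i * L (coord i) := by
  conv_lhs => rw [← sum_smul_coord v]
  simp

lemma gradient_apply (F : Plane → ℝ) (x : Plane) (i : Fin 2) :
    gradient F x i = fderiv ℝ F x (coord i) := by
  have h := toDual_symm_apply (𝕜 := ℝ) (x := coord i) (y := fderiv ℝ F x)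
  rw [EuclideanSpace.inner_single_right] at h
  simpa [gradient] using h

/-- The divergence of a vector field in the plane. -/
noncomputable def divergence (X : Plane → Plane) (x : Plane) : ℝ :=
  ∑ i, fderiv ℝ (fun y => X y i) x (coord i)

lemma contDiff_component {n : WithTop ℕ∞} {X : Plane → Plane} (hX : ContDiff ℝ n X) (i : Fin 2) :
    ContDiff ℝ n fun y => X y i :=
  contDiff_euclidean.1 hX i

lemma continuous_divergence {X : Plane → Plane} (hX : ContDiff ℝ 1 X) :
    Continuous (divergence X) := by
  unfold divergence
  refine continuous_finsetSum _ fun i _ => ?_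
  exact ((contDiff_component hX i).continuous_fderiv one_ne_zero).clm_apply continuous_const

lemma divergence_eq_zero_of_notMem_tsupport {X : Plane → Plane} {x : Plane}
    (hx : x ∉ tsupport X) : divergence X x = 0 := by
  have h := notMem_tsupport_iff_eventuallyEq.1 hx
  refine Finset.sum_eq_zero fun i _ => ?_
  have : (fun y => X y i) =ᶠ[𝓝 x] fun _ => (0 : ℝ) := by
    filter_upwards [h] with y hy
    simp [hy]
  rw [this.fderiv_eq]
  simp

lemma hasCompactSupport_divergence {X : Plane → Plane} (hX : HasCompactSupport X) :
    HasCompactSupport (divergence X) :=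
  hX.of_isClosed_subset (isClosed_tsupport _) <|
    closure_minimal (fun x hx => by
      by_contra h
      exact hx (divergence_eq_zero_of_notMem_tsupport h)) (isClosed_tsupport _)

lemma hasCompactSupport_component {X : Plane → Plane} (hX : HasCompactSupport X) (i : Fin 2) :
    HasCompactSupport fun y => X y i :=
  hX.comp_left (g := fun v : Plane => v i) rfl

/-- Integration by parts for a function and a vector field, one of them compactly supported. -/
theorem integral_fderiv_apply_eq_neg_integral_mul_divergence {F : Plane → ℝ} {X : Plane → Plane}
    (hF : ContDiff ℝ 1 F) (hX : ContDiff ℝ 1 X) (hc : HasCompactSupport F ∨ HasCompactSupport X) :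
    ∫ x, fderiv ℝ F x (X x) = -∫ x, F x * divergence X x := by
  have hF' : ∀ i, Continuous fun x => fderiv ℝ F x (coord i) := fun i =>
    (hF.continuous_fderiv one_ne_zero).clm_apply continuous_const
  have hX' : ∀ i, Continuous fun x => fderiv ℝ (fun y => X y i) x (coord i) := fun i =>
    ((contDiff_component hX i).continuous_fderiv one_ne_zero).clm_apply continuous_const
  have cX := fun i => (contDiff_component hX i).continuous
  have i1 : ∀ i, Integrable fun x => fderiv ℝ (fun y => X y i) x (coord i) * F x := fun i => by
    refine ((hX' i).mul hF.continuous).integrable_of_hasCompactSupport ?_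
    rcases hc with hc | hc
    · exact hc.mul_left
    · exact ((hasCompactSupport_component hc i).fderiv_apply ℝ (coord i)).mul_right
  have i2 : ∀ i, Integrable fun x => X x i * fderiv ℝ F x (coord i) := fun i => by
    refine ((cX i).mul (hF' i)).integrable_of_hasCompactSupport ?_
    rcases hc with hc | hc
    · exact (hc.fderiv_apply ℝ (coord i)).mul_left
    · exact (hasCompactSupport_component hc i).mul_right
  have i3 : ∀ i, Integrable fun x => X x i * F x := fun i => by
    refine ((cX i).mul hF.continuous).integrable_of_hasCompactSupport ?_
    rcases hc with hc | hc
    · exact hc.mul_left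
    · exact (hasCompactSupport_component hc i).mul_right
  simp_rw [map_eq_sum_coord (fderiv ℝ F _) (X _)]
  rw [integral_finsetSum _ fun i _ => i2 i]
  have key : ∀ i, ∫ x, X x i * fderiv ℝ F x (coord i)
      = -∫ x, fderiv ℝ (fun y => X y i) x (coord i) * F x := fun i =>
    integral_mul_fderiv_eq_neg_fderiv_mul_of_integrable (i1 i) (i2 i) (i3 i)
      (fun x _ => ((contDiff_component hX i).differentiable one_ne_zero) x)
      (fun x _ => (hF.differentiable one_ne_zero) x)
  simp_rw [key]
  rw [Finset.sum_neg_distrib, ← integral_finsetSum _ fun i _ => i1 i]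
  congr 2
  ext x
  rw [divergence, Finset.mul_sum]
  exact Finset.sum_congr rfl fun i _ => mul_comm _ _

/-- The divergence theorem for compactly supported vector fields. -/
theorem integral_divergence_eq_zero {X : Plane → Plane} (hX : ContDiff ℝ 1 X)
    (hc : HasCompactSupport X) : ∫ x, divergence X x = 0 := by
  have := integral_fderiv_apply_eq_neg_integral_mul_divergence (F := fun _ => (1 : ℝ))
    contDiff_const hX (Or.inr hc)
  simpa using this

/-! ### A smooth approximation of the indicator function of the negative half-line -/

/-- A smooth nonincreasing function that is `1` on `(-∞, -2ε]` and `0` on `[-ε, ∞)`. -/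
noncomputable def stepDown (ε r : ℝ) : ℝ := Real.smoothTransition (-(r / ε) - 1)

lemma contDiff_stepDown (ε : ℝ) : ContDiff ℝ ∞ (stepDown ε) :=
  Real.smoothTransition.contDiff.comp (((contDiff_id.div_const ε).neg).sub contDiff_const)

lemma stepDown_nonneg (ε r : ℝ) : 0 ≤ stepDown ε r := Real.smoothTransition.nonneg _

lemma stepDown_le_one (ε r : ℝ) : stepDown ε r ≤ 1 := Real.smoothTransition.le_one _

lemma stepDown_eq_zero {ε r : ℝ} (hε : 0 < ε) (hr : -ε ≤ r) : stepDown ε r = 0 := by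
  refine Real.smoothTransition.zero_of_nonpos ?_
  have : -1 ≤ r / ε := by rw [le_div_iff₀ hε]; linarith
  linarith

lemma stepDown_eq_one {ε r : ℝ} (hε : 0 < ε) (hr : r ≤ -2 * ε) : stepDown ε r = 1 := by
  refine Real.smoothTransition.one_of_one_le ?_
  have : r / ε ≤ -2 := by rw [div_le_iff₀ hε]; linarith
  linarith

lemma antitone_stepDown {ε : ℝ} (hε : 0 < ε) : Antitone (stepDown ε) := fun a b hab => by
  refine Real.smoothTransition.monotone ?_
  have : a / ε ≤ b / ε := by gcongr
  linarith

lemma deriv_stepDown_nonpos {ε : ℝ} (hε : 0 < ε) (r : ℝ) : deriv (stepDown ε) r ≤ 0 :=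
  (antitone_stepDown hε).deriv_nonpos

lemma deriv_stepDown_eq_zero_of_lt {ε r : ℝ} (hε : 0 < ε) (hr : -ε < r) :
    deriv (stepDown ε) r = 0 := by
  have : stepDown ε =ᶠ[𝓝 r] fun _ => (0 : ℝ) := by
    filter_upwards [Ioi_mem_nhds hr] with s hs using stepDown_eq_zero hε hs.le
  rw [this.deriv_eq, deriv_const]

lemma deriv_stepDown_eq_zero_of_gt {ε r : ℝ} (hε : 0 < ε) (hr : r < -2 * ε) :
    deriv (stepDown ε) r = 0 := by
  have : stepDown ε =ᶠ[𝓝 r] fun _ => (1 : ℝ) := by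
    filter_upwards [Iio_mem_nhds hr] with s hs using stepDown_eq_one hε hs.le
  rw [this.deriv_eq, deriv_const]

lemma continuous_deriv_stepDown (ε : ℝ) : Continuous (deriv (stepDown ε)) :=
  (contDiff_stepDown ε).continuous_deriv (by simp)

lemma exists_abs_deriv_stepDown_le {ε : ℝ} (hε : 0 < ε) :
    ∃ C, 0 ≤ C ∧ ∀ r, |deriv (stepDown ε) r| ≤ C := by
  obtain ⟨C, hC⟩ := (isCompact_Icc (a := -2 * ε) (b := -ε)).exists_bound_of_continuousOn
    (continuous_deriv_stepDown ε).continuousOn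
  refine ⟨max C 0, le_max_right _ _, fun r => ?_⟩
  by_cases h1 : r < -2 * ε
  · simp [deriv_stepDown_eq_zero_of_gt hε h1]
  by_cases h2 : -ε < r
  · simp [deriv_stepDown_eq_zero_of_lt hε h2]
  exact (hC r ⟨not_lt.1 h1, not_lt.1 h2⟩).trans (le_max_left _ _)

/-- The cutoffs are eventually constant in `ε` at each `r`. They vanish at `r = 0` too, so the limit
is the indicator of the open half-line at every point, with no exceptional set. -/
lemma tendsto_stepDown (r : ℝ) :
    Tendsto (fun ε => stepDown ε r) (𝓝[>] 0) (𝓝 ((Iio (0 : ℝ)).indicator 1 r)) := by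
  refine tendsto_const_nhds.congr' ?_
  rcases lt_or_ge r 0 with hr | hr
  · filter_upwards [self_mem_nhdsWithin,
      mem_nhdsWithin_of_mem_nhds (Iio_mem_nhds (show (0 : ℝ) < -r / 2 by linarith))] with ε h1 h2
    rw [stepDown_eq_one h1 (by rw [mem_Iio] at h2; linarith)]
    simp [hr]
  · filter_upwards [self_mem_nhdsWithin] with ε (h1 : 0 < ε)
    rw [stepDown_eq_zero h1 (by linarith)]
    simp [hr.not_gt]

lemma fderiv_stepDown_comp {G : Plane → ℝ} (hG : ContDiff ℝ 1 G) (ε : ℝ) (x : Plane) :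
    fderiv ℝ (fun y => stepDown ε (G y)) x = deriv (stepDown ε) (G x) • fderiv ℝ G x :=
  ((((contDiff_stepDown ε).differentiable (by simp)) (G x)).hasDerivAt.comp_hasFDerivAt x
    ((hG.differentiable one_ne_zero) x).hasFDerivAt).fderiv

lemma contDiff_stepDown_comp {G : Plane → ℝ} (hG : ContDiff ℝ 1 G) (ε : ℝ) :
    ContDiff ℝ 1 fun y => stepDown ε (G y) :=
  ((contDiff_stepDown ε).of_le (by simp)).comp hG

/-- Let `X` be a vector field that is transversal to the level sets of `G` near its zero level. A
density `A` on these level sets that is close to the flux of `-Y` through them has an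
integral close to the integral of the divergence of `Y` over `{G < 0}`. -/
theorem abs_integral_deriv_stepDown_sub_le {G A : Plane → ℝ} {X Y : Plane → Plane} {ε η : ℝ}
    (hε : 0 < ε) (hη : 0 ≤ η) (hG : ContDiff ℝ 1 G) (hX : ContDiff ℝ 1 X) (hY : ContDiff ℝ 1 Y)
    (hXc : HasCompactSupport X) (hc : HasCompactSupport fun x => stepDown ε (G x))
    (hA : Integrable fun x => deriv (stepDown ε) (G x) * A x)
    (hbound : ∀ x, -2 * ε ≤ G x → G x ≤ -ε →
      |A x + fderiv ℝ G x (Y x)| ≤ η * fderiv ℝ G x (X x)) :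
    |(∫ x, deriv (stepDown ε) (G x) * A x) - ∫ x, stepDown ε (G x) * divergence Y x|
      ≤ η * ∫ x, |divergence X x| := by
  have hβ := contDiff_stepDown_comp hG ε
  have cβ : Continuous (fderiv ℝ fun y => stepDown ε (G y)) := hβ.continuous_fderiv one_ne_zero
  have iY : Integrable fun x => fderiv ℝ (fun y => stepDown ε (G y)) x (Y x) :=
    (cβ.clm_apply hY.continuous).integrable_of_hasCompactSupport
      ((hc.fderiv (𝕜 := ℝ)).mono' fun x hx => by
        refine subset_closure fun h => hx ?_
        simp [h])
  have iX : Integrable fun x => fderiv ℝ (fun y => stepDown ε (G y)) x (X x) :=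
    (cβ.clm_apply hX.continuous).integrable_of_hasCompactSupport
      ((hc.fderiv (𝕜 := ℝ)).mono' fun x hx => by
        refine subset_closure fun h => hx ?_
        simp [h])
  have e1 : -∫ x, stepDown ε (G x) * divergence Y x
      = ∫ x, fderiv ℝ (fun y => stepDown ε (G y)) x (Y x) :=
    (integral_fderiv_apply_eq_neg_integral_mul_divergence hβ hY (Or.inl hc)).symm
  have e2 : ∫ x, stepDown ε (G x) * divergence X x
      = -∫ x, fderiv ℝ (fun y => stepDown ε (G y)) x (X x) := by
    rw [integral_fderiv_apply_eq_neg_integral_mul_divergence hβ hX (Or.inl hc), neg_neg]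
  rw [sub_eq_add_neg, e1, ← integral_add hA iY]
  -- The derivative of the cutoff is nonpositive and vanishes outside the layer where `hbound`
  -- holds. The error is thus dominated by `-η ∇(β_ε ∘ G) · X`, and integrating this by parts gives
  -- `η ∫ β_ε(G) div X`, which is bounded independently of `ε`.
  have step1 : |∫ x, (deriv (stepDown ε) (G x) * A x
      + fderiv ℝ (fun y => stepDown ε (G y)) x (Y x))|
      ≤ ∫ x, -(η * fderiv ℝ (fun y => stepDown ε (G y)) x (X x)) := by
    rw [← Real.norm_eq_abs]
    refine norm_integral_le_of_norm_le (iX.const_mul η).neg (Eventually.of_forall fun x => ?_)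
    rw [fderiv_stepDown_comp hG]
    by_cases h1 : G x < -2 * ε
    · simp [deriv_stepDown_eq_zero_of_gt hε h1]
    by_cases h2 : -ε < G x
    · simp [deriv_stepDown_eq_zero_of_lt hε h2]
    have h3 := hbound x (not_lt.1 h1) (not_lt.1 h2)
    have h4 := deriv_stepDown_nonpos hε (G x)
    have : deriv (stepDown ε) (G x) * A x + (deriv (stepDown ε) (G x) • fderiv ℝ G x) (Y x)
        = deriv (stepDown ε) (G x) * (A x + fderiv ℝ G x (Y x)) := by
      simp; ring
    rw [this, Real.norm_eq_abs, abs_mul, abs_of_nonpos h4]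
    calc _ ≤ -deriv (stepDown ε) (G x) * (η * fderiv ℝ G x (X x)) := by
          gcongr; linarith
      _ = _ := by simp; ring
  refine step1.trans ?_
  rw [integral_neg, integral_const_mul, ← mul_neg, ← e2]
  refine mul_le_mul_of_nonneg_left ?_ hη
  have cX := continuous_divergence hX
  refine integral_mono ?_ (cX.integrable_of_hasCompactSupport
    (hasCompactSupport_divergence hXc)).abs fun x => ?_
  · exact (hβ.continuous.mul cX).integrable_of_hasCompactSupport hc.mul_right
  · refine (le_abs_self _).trans ?_
    rw [abs_mul, abs_of_nonneg (stepDown_nonneg _ _)]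
    exact mul_le_of_le_one_left (abs_nonneg _) (stepDown_le_one _ _)

/-! ### Behaviour near a zero level set -/

/-- A property that holds near every zero of `G` in a compact set holds where `|G|` is small. -/
lemma exists_forall_abs_lt_of_eventually {K : Set Plane} (hK : IsCompact K) {G : Plane → ℝ}
    (hG : Continuous G) {P : Plane → Prop} (h : ∀ x ∈ K, G x = 0 → ∀ᶠ y in 𝓝[K] x, P y) :
    ∃ m > 0, ∀ x ∈ K, |G x| < m → P x := by
  by_contra! hcon
  have hpos : ∀ n : ℕ, (0 : ℝ) < 1 / (n + 1) := fun n => by positivity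
  choose x hxK hxG hxP using fun n : ℕ => hcon _ (hpos n)
  obtain ⟨a, haK, φ, hφ, hlim⟩ := hK.tendsto_subseq hxK
  have h0 : Tendsto (fun n => |G (x (φ n))|) atTop (𝓝 0) :=
    squeeze_zero (fun _ => abs_nonneg _) (fun n => (hxG (φ n)).le)
      (tendsto_one_div_add_atTop_nhds_zero_nat.comp hφ.tendsto_atTop)
  have ha : G a = 0 :=
    abs_eq_zero.1 (tendsto_nhds_unique ((hG.abs.tendsto a).comp hlim) h0)
  have hw : Tendsto (x ∘ φ) atTop (𝓝[K] a) :=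
    tendsto_nhdsWithin_iff.2 ⟨hlim, Eventually.of_forall fun n => hxK _⟩
  obtain ⟨n, hn⟩ := (hw.eventually (h a haK ha)).exists
  exact hxP _ hn

/-- There is a smooth compactly supported vector field transversal to a regular compact
level set. -/
theorem exists_transversal_field {G : Plane → ℝ} (hG : ContDiff ℝ 1 G)
    (hreg : ∀ x, G x = 0 → fderiv ℝ G x ≠ 0) {V : Set Plane} (hVo : IsOpen V)
    (hV : IsCompact (closure V)) (hΓ : {x | G x = 0} ⊆ V) :
    ∃ X : Plane → Plane, ContDiff ℝ 1 X ∧ HasCompactSupport X ∧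
      (∀ x, 0 ≤ fderiv ℝ G x (X x)) ∧ ∀ x, G x = 0 → 1 < fderiv ℝ G x (X x) := by
  have cG : Continuous (fderiv ℝ G) := hG.continuous_fderiv one_ne_zero
  -- All three conditions are convex in `v`, so locally constant choices can be glued by a partition
  -- of unity. The last condition forces compact support. Near the zero level the local choice is
  -- scaled to the value `2`, which leaves room for `> 1` nearby; elsewhere it is `0`.
  let t : Plane → Set Plane := fun x =>
    {v | 0 ≤ fderiv ℝ G x v ∧ (G x = 0 → 1 < fderiv ℝ G x v) ∧ (x ∉ V → v = 0)}
  have hconv : ∀ x, Convex ℝ (t x) := by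
    intro x v hv w hw a b ha hb hab
    refine ⟨?_, fun hx => ?_, fun hx => ?_⟩
    · have h1 := hv.1
      have h2 := hw.1
      simp only [map_add, map_smul, smul_eq_mul]
      positivity
    · have h1 := hv.2.1 hx
      have h2 := hw.2.1 hx
      simp only [map_add, map_smul, smul_eq_mul]
      exact convex_Ioi (1 : ℝ) h1 h2 ha hb hab
    · simp [hv.2.2 hx, hw.2.2 hx]
  have hloc : ∀ x, ∃ c, ∀ᶠ y in 𝓝 x, c ∈ t y := by
    intro x
    by_cases hx : G x = 0
    · obtain ⟨v, hv⟩ : ∃ v, fderiv ℝ G x v ≠ 0 := by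
        by_contra! h
        exact hreg x hx (ContinuousLinearMap.ext h)
      refine ⟨(2 / fderiv ℝ G x v) • v, ?_⟩
      have h2 : 1 < fderiv ℝ G x ((2 / fderiv ℝ G x v) • v) := by
        rw [map_smul, smul_eq_mul, div_mul_cancel₀ _ hv]; norm_num
      have hcont : Continuous fun y => fderiv ℝ G y ((2 / fderiv ℝ G x v) • v) :=
        cG.clm_apply continuous_const
      filter_upwards [hcont.continuousAt.eventually (lt_mem_nhds h2),
        hVo.mem_nhds (hΓ hx)] with y h1 h3
      exact ⟨by linarith, fun _ => h1, fun h => absurd h3 h⟩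
    · refine ⟨0, ?_⟩
      filter_upwards [hG.continuous.continuousAt.eventually_ne hx] with y hy
      exact ⟨by simp, fun h => absurd h hy, fun _ => rfl⟩
  obtain ⟨X, hX⟩ := exists_contMDiffMap_forall_mem_convex_of_local_const (n := 1)
    (modelWithCornersSelf ℝ Plane) hconv hloc
  refine ⟨X, X.contMDiff.contDiff, ?_, fun x => (hX x).1, fun x => (hX x).2.1⟩
  refine hV.of_isClosed_subset (isClosed_tsupport _) (closure_mono fun x hx => ?_)
  by_contra h
  exact hx ((hX x).2.2 h)

/-- There is a smooth vector field whose flux through a regular level set approximates a given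
continuous function. -/
theorem exists_field_with_flux {G a : Plane → ℝ} (hG : ContDiff ℝ 1 G)
    (hreg : ∀ x, G x = 0 → fderiv ℝ G x ≠ 0) (ha : ∀ x, G x = 0 → ContinuousAt a x)
    {η : ℝ} (hη : 0 < η) :
    ∃ Y : Plane → Plane, ContDiff ℝ 1 Y ∧ ∀ x, G x = 0 → |a x + fderiv ℝ G x (Y x)| < η := by
  have cG : Continuous (fderiv ℝ G) := hG.continuous_fderiv one_ne_zero
  -- Again a convex condition, solved exactly at a point and then kept constant nearby. Since `a`
  -- and the derivative of `G` are only continuous, an explicit field with exact flux, such as `-a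
  -- ∇G / |∇G|²`, need not be `C¹`; the tolerance `η` makes room for gluing.
  let t : Plane → Set Plane := fun x => {v | G x = 0 → |a x + fderiv ℝ G x v| < η}
  have hconv : ∀ x, Convex ℝ (t x) := by
    intro x v hv w hw α β hα hβ hab hx
    have h1 := abs_lt.1 (hv hx)
    have h2 := abs_lt.1 (hw hx)
    have h3 : a x + fderiv ℝ G x (α • v + β • w)
        = α * (a x + fderiv ℝ G x v) + β * (a x + fderiv ℝ G x w) := by
      simp only [map_add, map_smul, smul_eq_mul]
      linear_combination (-a x) * hab
    rw [h3, abs_lt]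
    exact convex_Ioo (-η) η h1 h2 hα hβ hab
  have hloc : ∀ x, ∃ c, ∀ᶠ y in 𝓝 x, c ∈ t y := by
    intro x
    by_cases hx : G x = 0
    · obtain ⟨v, hv⟩ : ∃ v, fderiv ℝ G x v ≠ 0 := by
        by_contra! h
        exact hreg x hx (ContinuousLinearMap.ext h)
      refine ⟨(-a x / fderiv ℝ G x v) • v, ?_⟩
      have hcont : ContinuousAt
          (fun y => |a y + fderiv ℝ G y ((-a x / fderiv ℝ G x v) • v)|) x :=
        ((ha x hx).add (cG.clm_apply continuous_const).continuousAt).abs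
      have h2 : |a x + fderiv ℝ G x ((-a x / fderiv ℝ G x v) • v)| < η := by
        rw [map_smul, smul_eq_mul, div_mul_cancel₀ _ hv]; simpa using hη
      filter_upwards [hcont.eventually (gt_mem_nhds h2)] with y h1 _ using h1
    · refine ⟨0, ?_⟩
      filter_upwards [hG.continuous.continuousAt.eventually_ne hx] with y hy h
      exact absurd h hy
  obtain ⟨Y, hY⟩ := exists_contMDiffMap_forall_mem_convex_of_local_const (n := 1)
    (modelWithCornersSelf ℝ Plane) hconv hloc
  exact ⟨Y, Y.contMDiff.contDiff, hY⟩

/-- A regular compact level set of a continuously differentiable function is a null set. -/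
theorem volume_zeroLevel_eq_zero {G : Plane → ℝ} (hG : ContDiff ℝ 1 G)
    (hreg : ∀ x, G x = 0 → fderiv ℝ G x ≠ 0) (hb : Bornology.IsBounded {x | G x = 0}) :
    volume {x | G x = 0} = 0 := by
  have hΓc : IsCompact {x | G x = 0} :=
    Metric.isCompact_of_isClosed_isBounded (isClosed_eq hG.continuous continuous_const) hb
  obtain ⟨V, hVo, hΓV, -, hV⟩ :=
    exists_open_between_and_isCompact_closure hΓc isOpen_univ (subset_univ _)
  obtain ⟨X, hX, hXc, hX0, hX1⟩ := exists_transversal_field hG hreg hVo hV hΓV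
  have cX := continuous_divergence hX
  have iX : Integrable fun x => |divergence X x| :=
    (cX.integrable_of_hasCompactSupport (hasCompactSupport_divergence hXc)).abs
  have hmeas : MeasurableSet {x | G x = 0} := hΓc.measurableSet
  have hfin : volume {x | G x = 0} ≠ ⊤ := hΓc.measure_lt_top.ne
  -- The function `arctan (n G)` has derivative at least `n` along `X` on the zero level, yet it is
  -- bounded by `π / 2` for every `n`. Integration by parts therefore bounds `n` times the measure
  -- of the level set by a constant.
  have key : ∀ n : ℝ, 0 < n →
      n * volume.real {x | G x = 0} ≤ ∫ x, Real.pi / 2 * |divergence X x| := by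
    intro n hn
    have hF : ContDiff ℝ 1 fun x => Real.arctan (n * G x) :=
      Real.contDiff_arctan.comp (contDiff_const.mul hG)
    have hD : ∀ x, fderiv ℝ (fun x => Real.arctan (n * G x)) x
        = ((1 / (1 + (n * G x) ^ 2)) * n) • fderiv ℝ G x := fun x => by
      have h1 := (((hG.differentiable one_ne_zero) x).hasFDerivAt.const_mul n).arctan
      rw [h1.fderiv, smul_smul]
    have e := integral_fderiv_apply_eq_neg_integral_mul_divergence hF hX (Or.inr hXc)
    have iF : Integrable fun x => fderiv ℝ (fun x => Real.arctan (n * G x)) x (X x) :=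
      ((hF.continuous_fderiv one_ne_zero).clm_apply hX.continuous).integrable_of_hasCompactSupport
        (hXc.mono' fun x hx => subset_closure fun h => hx (by simp [h]))
    have nonneg : ∀ x, 0 ≤ fderiv ℝ (fun x => Real.arctan (n * G x)) x (X x) := fun x => by
      rw [hD]
      have := hX0 x
      simp only [smul_apply, smul_eq_mul]
      positivity
    calc n * volume.real {x | G x = 0} = ∫ x in {x | G x = 0}, n := by
          rw [setIntegral_const, smul_eq_mul, mul_comm]
      _ ≤ ∫ x in {x | G x = 0}, fderiv ℝ (fun x => Real.arctan (n * G x)) x (X x) := by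
          refine setIntegral_mono_on (integrableOn_const hfin) iF.integrableOn
            hmeas fun x (hx : G x = 0) => ?_
          rw [hD]
          have := hX1 x hx
          simp only [smul_apply, smul_eq_mul, hx]
          norm_num
          nlinarith
      _ ≤ ∫ x, fderiv ℝ (fun x => Real.arctan (n * G x)) x (X x) :=
          setIntegral_le_integral iF (Eventually.of_forall nonneg)
      _ ≤ |∫ x, Real.arctan (n * G x) * divergence X x| := by
          rw [e]; exact neg_le_abs _
      _ ≤ ∫ x, Real.pi / 2 * |divergence X x| := by
          rw [← Real.norm_eq_abs]
          refine norm_integral_le_of_norm_le (iX.const_mul _) (Eventually.of_forall fun x => ?_)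
          rw [Real.norm_eq_abs, abs_mul]
          gcongr
          exact abs_le.2 ⟨(Real.neg_pi_div_two_lt_arctan _).le, (Real.arctan_lt_pi_div_two _).le⟩
  have hz : volume.real {x | G x = 0} = 0 := by
    by_contra hne
    have hpos : 0 < volume.real {x | G x = 0} := lt_of_le_of_ne measureReal_nonneg (Ne.symm hne)
    set C := ∫ x, Real.pi / 2 * |divergence X x|
    have hC : 0 ≤ C := integral_nonneg fun x => by positivity
    have := key ((C + 1) / volume.real {x | G x = 0}) (by positivity)
    rw [div_mul_cancel₀ _ hne] at this
    linarith
  exact (measureReal_eq_zero_iff hfin).1 hz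

/-! ### Mollification -/

open scoped Convolution in
-- The derivative of a convolution comes out in terms of `precompR`. This form shows it as the
-- mollification of the derivative, to which the same approximation estimates apply.
lemma convolution_precompR_lsmul (ρ : Plane → ℝ) (ψ' : Plane → Plane →L[ℝ] ℝ) (x : Plane) :
    (ρ ⋆[(ContinuousLinearMap.lsmul ℝ ℝ).precompR Plane, volume] ψ') x
      = (ρ ⋆[ContinuousLinearMap.lsmul ℝ ℝ, volume] ψ') x := by
  rfl

open scoped Convolution in
-- At a point outside the thickening, `f` vanishes on the whole ball over which the mollifier
-- averages.
lemma tsupport_convolution_subset_cthickening {E : Type*} [NormedAddCommGroup E] [NormedSpace ℝ E]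
    [CompleteSpace E] (b : ContDiffBump (0 : Plane)) (f : Plane → E) {δ : ℝ} (hb : b.rOut ≤ δ) :
    tsupport (b.normed volume ⋆[ContinuousLinearMap.lsmul ℝ ℝ, volume] f)
      ⊆ Metric.cthickening δ (tsupport f) := by
  refine closure_minimal (fun x hx => ?_) Metric.isClosed_cthickening
  by_contra h
  have hz : ∀ y ∈ Metric.closedBall x δ, f y = 0 := by
    intro y hy
    by_contra hne
    refine h (Metric.mem_cthickening_of_dist_le x y δ _ (subset_tsupport f hne) ?_)
    rw [dist_comm]
    exact Metric.mem_closedBall.1 hy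
  have hδ : 0 ≤ δ := b.rOut_pos.le.trans hb
  have hx0 : f x = 0 := hz x (Metric.mem_closedBall_self hδ)
  refine hx ?_
  rw [ContDiffBump.normed_convolution_eq_right (μ := volume) (φ := b) (x₀ := x), hx0]
  intro y hy
  rw [hx0, hz y (Metric.ball_subset_closedBall (Metric.ball_subset_ball hb hy))]

/-- A compactly supported continuously differentiable function is approximated, together with its
derivative, by smooth functions of almost the same support. -/
theorem exists_smooth_approx {ψ : Plane → ℝ} (hψ : ContDiff ℝ 1 ψ) (hc : HasCompactSupport ψ)
    {δ : ℝ} (hδ : 0 < δ) :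
    ∃ φ : Plane → ℝ, ContDiff ℝ ∞ φ ∧ HasCompactSupport φ ∧
      tsupport φ ⊆ Metric.cthickening δ (tsupport ψ) ∧
      tsupport (fderiv ℝ φ) ⊆ Metric.cthickening δ (tsupport (fderiv ℝ ψ)) ∧
      (∀ x, |φ x - ψ x| ≤ δ) ∧ ∀ x, ‖fderiv ℝ φ x - fderiv ℝ ψ x‖ ≤ δ := by
  have cψ' : Continuous (fderiv ℝ ψ) := hψ.continuous_fderiv one_ne_zero
  have u1 := Metric.uniformContinuous_iff.1 (hc.uniformContinuous_of_continuous hψ.continuous) δ hδ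
  have u2 := Metric.uniformContinuous_iff.1
    ((hc.fderiv (𝕜 := ℝ)).uniformContinuous_of_continuous cψ') δ hδ
  obtain ⟨r1, hr1, h1⟩ := u1
  obtain ⟨r2, hr2, h2⟩ := u2
  set r := min (min r1 r2) δ with hr
  have hrpos : 0 < r := by positivity
  let b : ContDiffBump (0 : Plane) := ⟨r / 2, r, by positivity, by linarith⟩
  have hb : b.rOut ≤ δ := min_le_right _ _
  let φ := convolution (b.normed volume) ψ (ContinuousLinearMap.lsmul ℝ ℝ) volume
  have hbl : LocallyIntegrable (b.normed volume) volume :=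
    b.continuous_normed.locallyIntegrable
  have hφ' : fderiv ℝ φ
      = convolution (b.normed volume) (fderiv ℝ ψ) (ContinuousLinearMap.lsmul ℝ ℝ) volume := by
    ext1 x
    rw [(hc.hasFDerivAt_convolution_right (ContinuousLinearMap.lsmul ℝ ℝ) hbl hψ x).fderiv,
      convolution_precompR_lsmul]
  refine ⟨φ, ?_, ?_, ?_, ?_, fun x => ?_, fun x => ?_⟩
  · exact b.hasCompactSupport_normed.contDiff_convolution_left _ b.contDiff_normed
      hψ.continuous.locallyIntegrable
  · exact b.hasCompactSupport_normed.convolution _ hc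
  · exact tsupport_convolution_subset_cthickening b ψ hb
  · rw [hφ']
    exact tsupport_convolution_subset_cthickening b _ hb
  · refine b.dist_normed_convolution_le hψ.continuous.aestronglyMeasurable fun y hy => (h1 ?_).le
    exact lt_of_lt_of_le (Metric.mem_ball.1 hy) ((min_le_left _ _).trans (min_le_left _ _))
  · rw [hφ', ← dist_eq_norm]
    refine b.dist_normed_convolution_le cψ'.aestronglyMeasurable fun y hy => (h2 ?_).le
    exact lt_of_lt_of_le (Metric.mem_ball.1 hy) ((min_le_left _ _).trans (min_le_right _ _))

/-! ### The Laplacian and harmonic functions in the plane -/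

lemma laplacian_eq_sum {f : Plane → ℝ} {x : Plane} (hf : ContDiffAt ℝ 2 f x) :
    Δ f x = ∑ i, fderiv ℝ (fun y => fderiv ℝ f y (coord i)) x (coord i) := by
  rw [laplacian_eq_iteratedFDeriv_orthonormalBasis f (EuclideanSpace.basisFun (Fin 2) ℝ)]
  refine Finset.sum_congr rfl fun i _ => ?_
  have hd : DifferentiableAt ℝ (fderiv ℝ f) x :=
    (hf.fderiv_right (m := 1) (by norm_num)).differentiableAt one_ne_zero
  rw [iteratedFDeriv_two_apply, fderiv_clm_apply hd (differentiableAt_const _)]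
  simp

/-- The identification of the complex numbers with the Euclidean plane. -/
noncomputable abbrev complexPlane : ℂ ≃ₗᵢ[ℝ] Plane := Complex.orthonormalBasisOneI.repr

/-- The identification is an isometry and matches the orthonormal bases, in either of which the
Laplacian is the sum of pure second derivatives. -/
lemma laplacian_comp_complexPlane (u : Plane → ℝ) (z : ℂ) :
    Δ (u ∘ complexPlane) z = Δ u (complexPlane z) := by
  rw [laplacian_eq_iteratedFDeriv_orthonormalBasis u (EuclideanSpace.basisFun (Fin 2) ℝ),
    laplacian_eq_iteratedFDeriv_orthonormalBasis _ Complex.orthonormalBasisOneI]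
  refine Finset.sum_congr rfl fun i _ => ?_
  have h := complexPlane.toContinuousLinearEquiv.iteratedFDerivWithin_comp_right u
    uniqueDiffOn_univ (mem_univ (complexPlane z)) 2
  rw [preimage_univ, iteratedFDerivWithin_univ, iteratedFDerivWithin_univ] at h
  rw [show (u ∘ complexPlane) = u ∘ complexPlane.toContinuousLinearEquiv from rfl, h,
    ContinuousMultilinearMap.compContinuousLinearMap_apply]
  have hb : complexPlane (Complex.orthonormalBasisOneI i) = EuclideanSpace.basisFun (Fin 2) ℝ i := by
    rw [OrthonormalBasis.repr_self]
    simp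
  congr 1
  ext1 j
  fin_cases j <;> exact hb

/-- `HarmonicAt` demands only two derivatives; analyticity is imported from harmonic functions on
`ℂ`. Smoothness is needed because `u` times a smooth cutoff must be an admissible test function. -/
lemma contDiffAt_of_harmonicAt {u : Plane → ℝ} {x : Plane} (hu : HarmonicAt u x) :
    ContDiffAt ℝ ∞ u x := by
  have hh : HarmonicAt (u ∘ complexPlane) (complexPlane.symm x) := by
    refine ⟨?_, ?_⟩
    · refine ContDiffAt.comp _ ?_ complexPlane.contDiff.contDiffAt
      rw [complexPlane.apply_symm_apply]
      exact hu.1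
    · have ht : Tendsto complexPlane (𝓝 (complexPlane.symm x)) (𝓝 x) := by
        have := complexPlane.continuous.tendsto (complexPlane.symm x)
        rwa [complexPlane.apply_symm_apply] at this
      filter_upwards [ht.eventually hu.2] with z hz
      rw [laplacian_comp_complexPlane, hz]
      rfl
  have h1 : ContDiffAt ℝ ∞ (u ∘ complexPlane) (complexPlane.symm x) :=
    (_root_.HarmonicAt.analyticAt hh).contDiffAt
  have h2 := h1.comp x complexPlane.symm.contDiff.contDiffAt
  have : (u ∘ complexPlane) ∘ complexPlane.symm = u := by
    ext y
    exact congrArg u (complexPlane.apply_symm_apply y)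
  rwa [this] at h2

/-- The Laplacian of a harmonic function times a smooth function. -/
lemma laplacian_mul_of_harmonicAt {u ψ : Plane → ℝ} {x : Plane} (hu : HarmonicAt u x)
    (hψ : ContDiff ℝ ∞ ψ) :
    Δ (fun y => u y * ψ y) x = 2 * (∑ i, fderiv ℝ u x (coord i) * fderiv ℝ ψ x (coord i))
      + u x * ∑ i, fderiv ℝ (fun y => fderiv ℝ ψ y (coord i)) x (coord i) := by
  have hu2 : ContDiffAt ℝ 2 u x := hu.1
  have hψ2 : ContDiffAt ℝ 2 ψ x := hψ.contDiffAt.of_le (by norm_cast)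
  have hev : ∀ᶠ y in 𝓝 x, DifferentiableAt ℝ u y := by
    filter_upwards [hu2.eventually (by simp)] with y hy using hy.differentiableAt two_ne_zero
  have dψ : Differentiable ℝ ψ := hψ.differentiable (by simp)
  have du' : ∀ i, DifferentiableAt ℝ (fun y => fderiv ℝ u y (coord i)) x := fun i =>
    (((hu2.fderiv_right (m := 1) (by norm_num)).differentiableAt one_ne_zero)).clm_apply
      (differentiableAt_const _)
  have dψ' : ∀ i, DifferentiableAt ℝ (fun y => fderiv ℝ ψ y (coord i)) x := fun i =>
    (((hψ2.fderiv_right (m := 1) (by norm_num)).differentiableAt one_ne_zero)).clm_apply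
      (differentiableAt_const _)
  have h0 : ∑ i, fderiv ℝ (fun y => fderiv ℝ u y (coord i)) x (coord i) = 0 := by
    rw [← laplacian_eq_sum hu2]; exact hu.2.self_of_nhds
  have hterm : ∀ i, fderiv ℝ (fun y => fderiv ℝ (fun y => u y * ψ y) y (coord i)) x (coord i)
      = u x * fderiv ℝ (fun y => fderiv ℝ ψ y (coord i)) x (coord i)
        + 2 * (fderiv ℝ u x (coord i) * fderiv ℝ ψ x (coord i))
        + ψ x * fderiv ℝ (fun y => fderiv ℝ u y (coord i)) x (coord i) := by
    intro i
    have e : (fun y => fderiv ℝ (fun y => u y * ψ y) y (coord i)) =ᶠ[𝓝 x]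
        fun y => u y * fderiv ℝ ψ y (coord i) + ψ y * fderiv ℝ u y (coord i) := by
      filter_upwards [hev] with y hy
      rw [(hy.hasFDerivAt.fun_mul (dψ y).hasFDerivAt).fderiv]
      simp
    rw [e.fderiv_eq, ((hev.self_of_nhds.hasFDerivAt.fun_mul (dψ' i).hasFDerivAt).fun_add
      ((dψ x).hasFDerivAt.fun_mul (du' i).hasFDerivAt)).fderiv]
    simp
    ring
  rw [laplacian_eq_sum (hu2.mul hψ2)]
  simp_rw [hterm]
  rw [Finset.sum_add_distrib, Finset.sum_add_distrib, ← Finset.mul_sum, ← Finset.mul_sum,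
    ← Finset.mul_sum, h0]
  ring

lemma contDiff_gradient {φ : Plane → ℝ} (hφ : ContDiff ℝ ∞ φ) : ContDiff ℝ 1 (gradient φ) :=
  (toDual ℝ Plane).symm.contDiff.comp (hφ.fderiv_right (m := 1) (by norm_cast))

lemma tsupport_gradient_subset (φ : Plane → ℝ) : tsupport (gradient φ) ⊆ tsupport φ :=
  (closure_mono fun x (hx : gradient φ x ≠ 0) (h : fderiv ℝ φ x = 0) =>
    hx (by rw [gradient, h, map_zero])).trans (tsupport_fderiv_subset ℝ)

lemma laplacian_eq_divergence_gradient {φ : Plane → ℝ} (hφ : ContDiff ℝ ∞ φ) (x : Plane) :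
    Δ φ x = divergence (gradient φ) x := by
  rw [laplacian_eq_sum (hφ.contDiffAt.of_le (by norm_cast)), divergence]
  simp only [gradient_apply]

/-- The Laplacian of a test function has mean value zero. -/
lemma integral_laplacian_eq_zero {φ : Plane → ℝ} (hφ : ContDiff ℝ ∞ φ)
    (hc : HasCompactSupport φ) : ∫ x, Δ φ x = 0 := by
  simp_rw [laplacian_eq_divergence_gradient hφ]
  exact integral_divergence_eq_zero (contDiff_gradient hφ)
    (hc.of_isClosed_subset (isClosed_tsupport _) (tsupport_gradient_subset φ))

/-! ### Green's identity for the pressure -/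

/-- The integrand `(q ∇u - u ∇q) · ∇ψ` of Green's identity. -/
noncomputable def greenFlux (q u ψ : Plane → ℝ) (x : Plane) : ℝ :=
  q x * fderiv ℝ u x (gradient ψ x) - u x * fderiv ℝ q x (gradient ψ x)

lemma norm_gradient_sub (F G : Plane → ℝ) (x : Plane) :
    ‖gradient F x - gradient G x‖ = ‖fderiv ℝ F x - fderiv ℝ G x‖ := by
  rw [gradient, gradient, ← map_sub]
  exact (toDual ℝ Plane).symm.norm_map _

lemma gradient_eq_zero_of_notMem_tsupport {ψ : Plane → ℝ} {x : Plane}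
    (hx : x ∉ tsupport (fderiv ℝ ψ)) : gradient ψ x = 0 := by
  rw [gradient, image_eq_zero_of_notMem_tsupport hx, map_zero]

lemma continuous_gradient {ψ : Plane → ℝ} (hψ : ContDiff ℝ 1 ψ) : Continuous (gradient ψ) :=
  (toDual ℝ Plane).symm.continuous.comp (hψ.continuous_fderiv one_ne_zero)

lemma greenFlux_eq_zero_of_notMem_tsupport {q u ψ : Plane → ℝ} {x : Plane}
    (hx : x ∉ tsupport (fderiv ℝ ψ)) : greenFlux q u ψ x = 0 := by
  simp [greenFlux, gradient_eq_zero_of_notMem_tsupport hx]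

lemma tsupport_greenFlux_subset (q u ψ : Plane → ℝ) :
    tsupport (greenFlux q u ψ) ⊆ tsupport (fderiv ℝ ψ) :=
  closure_minimal (fun x hx => by
    by_contra h
    exact hx (greenFlux_eq_zero_of_notMem_tsupport h)) (isClosed_tsupport _)

lemma hasCompactSupport_greenFlux {q u ψ : Plane → ℝ} (hc : HasCompactSupport ψ) :
    HasCompactSupport (greenFlux q u ψ) :=
  (hc.fderiv (𝕜 := ℝ)).of_isClosed_subset (isClosed_tsupport _) (tsupport_greenFlux_subset q u ψ)

/-- The factor `∇ψ` kills the integrand wherever `q` is not known to be regular. -/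
lemma continuous_greenFlux {O : Set Plane} (hO : IsOpen O) {q u ψ : Plane → ℝ}
    (hq : ContDiffOn ℝ 1 q O) (hu : ContDiffOn ℝ 1 u O) (hψ : ContDiff ℝ 1 ψ)
    (hs : tsupport (fderiv ℝ ψ) ⊆ O) : Continuous (greenFlux q u ψ) := by
  refine continuous_of_tsupport fun x hx => ?_
  have hxO : O ∈ 𝓝 x := hO.mem_nhds (hs (tsupport_greenFlux_subset q u ψ hx))
  have cg := (continuous_gradient hψ).continuousAt (x := x)
  have h1 := (hq.continuousOn_fderiv_of_isOpen hO le_rfl).continuousAt hxO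
  have h2 := (hu.continuousOn_fderiv_of_isOpen hO le_rfl).continuousAt hxO
  exact ((hq.continuousOn.continuousAt hxO).mul (h2.clm_apply cg)).sub
    ((hu.continuousOn.continuousAt hxO).mul (h1.clm_apply cg))

lemma contDiff_of_contDiffAt_tsupport {n : WithTop ℕ∞} {E F : Type*} [NormedAddCommGroup E]
    [NormedSpace ℝ E] [NormedAddCommGroup F] [NormedSpace ℝ F] {f : E → F}
    (h : ∀ x ∈ tsupport f, ContDiffAt ℝ n f x) : ContDiff ℝ n f := by
  refine contDiff_iff_contDiffAt.2 fun x => ?_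
  by_cases hx : x ∈ tsupport f
  · exact h x hx
  · exact contDiffAt_const.congr_of_eventuallyEq (notMem_tsupport_iff_eventuallyEq.1 hx)

lemma eq_of_forall_abs_sub_le_mul {a b C δ₀ : ℝ} (h₀ : 0 < δ₀)
    (h : ∀ δ, 0 < δ → δ ≤ δ₀ → |a - b| ≤ C * δ) : a = b := by
  have ht : Tendsto (fun δ : ℝ => C * δ) (𝓝[>] 0) (𝓝 (C * 0)) :=
    (tendsto_id.const_mul C).mono_left nhdsWithin_le_nhds
  have h0 : |a - b| ≤ C * 0 := by
    refine ge_of_tendsto ht ?_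
    filter_upwards [self_mem_nhdsWithin, mem_nhdsWithin_of_mem_nhds (Iio_mem_nhds h₀)]
      with δ h1 h2 using h δ h1 (le_of_lt h2)
  rw [mul_zero] at h0
  exact sub_eq_zero.1 (abs_nonpos_iff.1 h0)

/-- Green's identity for a distributional solution `q` of a Poisson equation, a harmonic function
`u` and a smooth cutoff `ψ`. -/
theorem integral_greenFlux_of_smooth {D N : Set Plane} (hD : IsOpen D) (hN : IsOpen N)
    {c χ : ℝ} {S : Sources} {q u ψ : Plane → ℝ}
    (hp : ∀ φ : Plane → ℝ, ContDiff ℝ ∞ φ → HasCompactSupport φ → tsupport φ ⊆ D →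
      ∫ x in D, q x * (Δ φ) x = c * (∫ x in D, φ x) + χ * S.integral φ)
    (hq : ContDiffOn ℝ 1 q (D ∩ N)) (hu : ∀ x ∈ D, HarmonicAt u x)
    (hψ : ContDiff ℝ ∞ ψ) (hc : HasCompactSupport ψ) (hψD : tsupport ψ ⊆ D)
    (hψN : tsupport (fderiv ℝ ψ) ⊆ N) :
    ∫ x, greenFlux q u ψ x
      = c * (∫ x in D, u x * ψ x) + χ * S.integral (fun x => u x * ψ x) := by
  have hO : IsOpen (D ∩ N) := hD.inter hN
  have husm : ∀ x ∈ D, ContDiffAt ℝ ∞ u x := fun x hx => contDiffAt_of_harmonicAt (hu x hx)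
  have hu1 : ContDiffOn ℝ 1 u (D ∩ N) := fun x hx =>
    ((husm x hx.1).of_le (by norm_cast)).contDiffWithinAt
  have hψ1 : ContDiff ℝ 1 ψ := hψ.of_le (by norm_cast)
  have hψO : tsupport (fderiv ℝ ψ) ⊆ D ∩ N :=
    subset_inter ((tsupport_fderiv_subset ℝ).trans hψD) hψN
  have hφ : ContDiff ℝ ∞ fun x => u x * ψ x := contDiff_of_contDiffAt_tsupport fun x hx =>
    (husm x (hψD (tsupport_mul_subset_right hx))).mul hψ.contDiffAt
  rw [← hp _ hφ hc.mul_left (tsupport_mul_subset_right.trans hψD)]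
  -- This is `F = q u ∇ψ`. As `Δu = 0`, `q Δ(uψ) = 2 q ∇u·∇ψ + q u Δψ`, and subtracting `div F = q u
  -- Δψ + ∇(qu)·∇ψ` leaves exactly the Green flux. `F` is globally `C¹` because the support of `∇ψ`
  -- lies where `q` is `C¹`.
  let F : Plane → Plane := fun x =>
    WithLp.toLp 2 fun i => q x * u x * fderiv ℝ ψ x (coord i)
  have hFs : tsupport F ⊆ tsupport (fderiv ℝ ψ) :=
    closure_mono fun x hx h => hx (by ext i; simp [F, h])
  have hψ'1 : ∀ i, ContDiff ℝ 1 fun x => fderiv ℝ ψ x (coord i) := fun i =>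
    (hψ.fderiv_right (m := 1) (by norm_cast)).clm_apply contDiff_const
  have hF : ContDiff ℝ 1 F := contDiff_of_contDiffAt_tsupport fun x hx => by
    have hxO : D ∩ N ∈ 𝓝 x := hO.mem_nhds (hψO (hFs hx))
    refine contDiffAt_euclidean.2 fun i => ?_
    exact ((hq.contDiffAt hxO).mul (hu1.contDiffAt hxO)).mul (hψ'1 i).contDiffAt
  have hFc : HasCompactSupport F :=
    (hc.fderiv (𝕜 := ℝ)).of_isClosed_subset (isClosed_tsupport _) hFs
  have iF : Integrable (divergence F) :=
    (continuous_divergence hF).integrable_of_hasCompactSupport (hasCompactSupport_divergence hFc)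
  have iI : Integrable (greenFlux q u ψ) :=
    (continuous_greenFlux hO hq hu1 hψ1 hψO).integrable_of_hasCompactSupport
      (hasCompactSupport_greenFlux hc)
  have hpt : ∀ x ∈ D, q x * (Δ fun x => u x * ψ x) x = divergence F x + greenFlux q u ψ x := by
    intro x hxD
    rw [laplacian_mul_of_harmonicAt (hu x hxD) hψ]
    by_cases hx : x ∈ tsupport (fderiv ℝ ψ)
    · have hxO : D ∩ N ∈ 𝓝 x := hO.mem_nhds (hψO hx)
      have dq := (hq.contDiffAt hxO).differentiableAt one_ne_zero
      have du := (hu1.contDiffAt hxO).differentiableAt one_ne_zero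
      have hdiv : ∀ i, fderiv ℝ (fun y => F y i) x (coord i)
          = q x * u x * fderiv ℝ (fun y => fderiv ℝ ψ y (coord i)) x (coord i)
            + fderiv ℝ ψ x (coord i) * (q x * fderiv ℝ u x (coord i)
              + u x * fderiv ℝ q x (coord i)) := by
        intro i
        have h := (dq.hasFDerivAt.fun_mul du.hasFDerivAt).fun_mul
          (((hψ'1 i).differentiable one_ne_zero) x).hasFDerivAt
        have e : (fun y => F y i) = fun y => q y * u y * fderiv ℝ ψ y (coord i) := rfl
        rw [e, h.fderiv]
        simp
        ring
      rw [divergence, greenFlux, map_eq_sum_coord (fderiv ℝ u x),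
        map_eq_sum_coord (fderiv ℝ q x)]
      simp only [hdiv, gradient_apply, Fin.sum_univ_two]
      ring
    -- Here `ψ` is locally constant, so both sides vanish without any regularity of `q`.
    · have h0 := notMem_tsupport_iff_eventuallyEq.1 hx
      have hz : ∀ i, fderiv ℝ (fun y => fderiv ℝ ψ y (coord i)) x = 0 := fun i => by
        have : (fun y => fderiv ℝ ψ y (coord i)) =ᶠ[𝓝 x] fun _ => (0 : ℝ) := by
          filter_upwards [h0] with y hy
          simp [hy]
        rw [this.fderiv_eq]
        simp
      rw [divergence_eq_zero_of_notMem_tsupport fun h => hx (hFs h),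
        greenFlux_eq_zero_of_notMem_tsupport hx]
      simp [hz, h0.self_of_nhds]
  rw [setIntegral_congr_fun hD.measurableSet hpt, integral_add iF.integrableOn iI.integrableOn,
    setIntegral_eq_integral_of_forall_compl_eq_zero fun x hx =>
      divergence_eq_zero_of_notMem_tsupport fun h => hx (hψO (hFs h)).1,
    setIntegral_eq_integral_of_forall_compl_eq_zero fun x hx =>
      greenFlux_eq_zero_of_notMem_tsupport fun h => hx (hψO h).1,
    integral_divergence_eq_zero hF hFc, zero_add]

/-- The constant is the total variation of the measure `u μ`, carried by the curves and the points.
-/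
lemma abs_sources_integral_sub_le {S : Sources} {u φ ψ : Plane → ℝ} {δ : ℝ}
    (hS : IntegrableOn (fun x => u x * S.density x) S.cut μH[1])
    (hφ : Continuous φ) (hφc : HasCompactSupport φ) (hψ : Continuous ψ) (hψc : HasCompactSupport ψ)
    (h : ∀ x, |φ x - ψ x| ≤ δ) :
    |S.integral (fun x => u x * φ x) - S.integral (fun x => u x * ψ x)|
      ≤ ((∫ x in S.cut, |u x * S.density x| ∂μH[1]) + ∑ a ∈ S.points, |u a * S.strength a|) * δ := by
  have int : ∀ f : Plane → ℝ, Continuous f → HasCompactSupport f →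
      IntegrableOn (fun x => u x * f x * S.density x) S.cut μH[1] := fun f hf hfc => by
    obtain ⟨C, hC⟩ := hfc.exists_bound_of_continuous hf
    have := hS.bdd_mul (c := C) hf.aestronglyMeasurable (Eventually.of_forall hC)
    refine this.congr (Eventually.of_forall fun x => ?_)
    simp only
    ring
  have e : S.integral (fun x => u x * φ x) - S.integral (fun x => u x * ψ x)
      = (∫ x in S.cut, (φ x - ψ x) * (u x * S.density x) ∂μH[1])
        + ∑ a ∈ S.points, (φ a - ψ a) * (u a * S.strength a) := by
    rw [Sources.integral, Sources.integral, add_sub_add_comm, ← integral_sub (int φ hφ hφc)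
      (int ψ hψ hψc), ← Finset.sum_sub_distrib]
    congr 1
    · congr 1; ext x; ring
    · exact Finset.sum_congr rfl fun a _ => by ring
  rw [e, add_mul]
  refine (abs_add_le _ _).trans (add_le_add ?_ ?_)
  · rw [← Real.norm_eq_abs, ← integral_mul_const]
    refine norm_integral_le_of_norm_le (hS.abs.mul_const δ) (Eventually.of_forall fun x => ?_)
    rw [Real.norm_eq_abs, abs_mul, mul_comm]
    exact mul_le_mul_of_nonneg_left (h x) (abs_nonneg _)
  · rw [Finset.sum_mul]
    refine (Finset.abs_sum_le_sum_abs _ _).trans (Finset.sum_le_sum fun a _ => ?_)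
    rw [abs_mul, mul_comm]
    exact mul_le_mul_of_nonneg_left (h a) (abs_nonneg _)

/-- Green's identity with a cutoff that is merely continuously differentiable. -/
theorem integral_greenFlux {D N : Set Plane} (hD : IsOpen D) (hN : IsOpen N)
    {c χ : ℝ} {S : Sources} {q u ψ : Plane → ℝ}
    (hp : ∀ φ : Plane → ℝ, ContDiff ℝ ∞ φ → HasCompactSupport φ → tsupport φ ⊆ D →
      ∫ x in D, q x * (Δ φ) x = c * (∫ x in D, φ x) + χ * S.integral φ)
    (hq : ContDiffOn ℝ 1 q (D ∩ N)) (hu : ∀ x ∈ D, HarmonicAt u x) (huD : IntegrableOn u D)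
    (hS : IntegrableOn (fun x => u x * S.density x) S.cut μH[1])
    (hψ : ContDiff ℝ 1 ψ) (hc : HasCompactSupport ψ) (hψD : tsupport ψ ⊆ D)
    (hψN : tsupport (fderiv ℝ ψ) ⊆ N) :
    ∫ x, greenFlux q u ψ x
      = c * (∫ x in D, u x * ψ x) + χ * S.integral (fun x => u x * ψ x) := by
  have hO : IsOpen (D ∩ N) := hD.inter hN
  have hu1 : ContDiffOn ℝ 1 u (D ∩ N) := fun x hx =>
    ((contDiffAt_of_harmonicAt (hu x hx.1)).of_le (by norm_cast)).contDiffWithinAt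
  have hψO : tsupport (fderiv ℝ ψ) ⊆ D ∩ N :=
    subset_inter ((tsupport_fderiv_subset ℝ).trans hψD) hψN
  -- This is room for mollification: the smooth cutoffs must keep their support in `D`, and that of
  -- their gradient in `D ∩ N`, where `q` is `C¹`.
  obtain ⟨δ₁, hδ₁, hD₁⟩ := hc.isCompact.exists_cthickening_subset_open hD hψD
  obtain ⟨δ₂, hδ₂, hD₂⟩ :=
    (hc.fderiv (𝕜 := ℝ)).isCompact.exists_cthickening_subset_open hO hψO
  set K := Metric.cthickening δ₂ (tsupport (fderiv ℝ ψ))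
  have hK : IsCompact K := (hc.fderiv (𝕜 := ℝ)).isCompact.cthickening
  set w : Plane → ℝ := fun x => |q x| * ‖fderiv ℝ u x‖ + |u x| * ‖fderiv ℝ q x‖
  have hw : ContinuousOn w (D ∩ N) :=
    (hq.continuousOn.abs.mul (hu1.continuousOn_fderiv_of_isOpen hO le_rfl).norm).add
      (hu1.continuousOn.abs.mul (hq.continuousOn_fderiv_of_isOpen hO le_rfl).norm)
  have iw : IntegrableOn w K := (hw.mono hD₂).integrableOn_compact hK
  set C₁ := ∫ x in K, w x
  set C₂ := ∫ x in D, |u x|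
  set C₃ := (∫ x in S.cut, |u x * S.density x| ∂μH[1]) + ∑ a ∈ S.points, |u a * S.strength a|
  -- Both sides of the identity involve only `ψ` and its first derivative, so each changes by `O(δ)`
  -- under an approximation that is `δ`-close in `C¹`.
  refine eq_of_forall_abs_sub_le_mul (C := C₁ + |c| * C₂ + |χ| * C₃) (lt_min hδ₁ hδ₂)
    fun δ hδ hδ' => ?_
  obtain ⟨φ, hφ, hφc, hφs, hφs', hφ0, hφ1⟩ := exists_smooth_approx hψ hc hδ
  have hφ1' : ContDiff ℝ 1 φ := hφ.of_le (by norm_cast)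
  have hφD : tsupport φ ⊆ D :=
    hφs.trans ((Metric.cthickening_mono (hδ'.trans (min_le_left _ _)) _).trans hD₁)
  have hφK : tsupport (fderiv ℝ φ) ⊆ K :=
    hφs'.trans (Metric.cthickening_mono (hδ'.trans (min_le_right _ _)) _)
  have hψK : tsupport (fderiv ℝ ψ) ⊆ K := Metric.self_subset_cthickening _
  have key := integral_greenFlux_of_smooth hD hN hp hq hu hφ hφc hφD
    ((hφK.trans hD₂).trans inter_subset_right)
  have i1 : Integrable (greenFlux q u ψ) :=
    (continuous_greenFlux hO hq hu1 hψ hψO).integrable_of_hasCompactSupport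
      (hasCompactSupport_greenFlux hc)
  have i2 : Integrable (greenFlux q u φ) :=
    (continuous_greenFlux hO hq hu1 hφ1' (hφK.trans hD₂)).integrable_of_hasCompactSupport
      (hasCompactSupport_greenFlux hφc)
  have e1 : |(∫ x, greenFlux q u ψ x) - ∫ x, greenFlux q u φ x| ≤ C₁ * δ := by
    rw [← integral_sub i1 i2, ← setIntegral_eq_integral_of_forall_compl_eq_zero (s := K)
      fun x hx => by
        rw [greenFlux_eq_zero_of_notMem_tsupport fun h => hx (hψK h),
          greenFlux_eq_zero_of_notMem_tsupport fun h => hx (hφK h), sub_zero],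
      ← Real.norm_eq_abs, ← integral_mul_const]
    refine norm_integral_le_of_norm_le (iw.mul_const δ) (Eventually.of_forall fun x => ?_)
    have e : greenFlux q u ψ x - greenFlux q u φ x
        = q x * fderiv ℝ u x (gradient ψ x - gradient φ x)
          - u x * fderiv ℝ q x (gradient ψ x - gradient φ x) := by
      simp only [greenFlux, map_sub]; ring
    have hg : ‖gradient ψ x - gradient φ x‖ ≤ δ := by
      rw [norm_gradient_sub, norm_sub_rev]; exact hφ1 x
    have b1 : |fderiv ℝ u x (gradient ψ x - gradient φ x)| ≤ ‖fderiv ℝ u x‖ * δ :=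
      ((fderiv ℝ u x).le_opNorm _).trans (by gcongr)
    have b2 : |fderiv ℝ q x (gradient ψ x - gradient φ x)| ≤ ‖fderiv ℝ q x‖ * δ :=
      ((fderiv ℝ q x).le_opNorm _).trans (by gcongr)
    rw [e, Real.norm_eq_abs]
    calc _ ≤ |q x| * |fderiv ℝ u x (gradient ψ x - gradient φ x)|
          + |u x| * |fderiv ℝ q x (gradient ψ x - gradient φ x)| := by
          rw [← abs_mul, ← abs_mul]; exact abs_sub _ _
      _ ≤ |q x| * (‖fderiv ℝ u x‖ * δ) + |u x| * (‖fderiv ℝ q x‖ * δ) := by gcongr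
      _ = w x * δ := by simp only [w]; ring
  have int : ∀ f : Plane → ℝ, Continuous f → HasCompactSupport f →
      IntegrableOn (fun x => u x * f x) D := fun f hf hfc => by
    obtain ⟨C, hC⟩ := hfc.exists_bound_of_continuous hf
    have := huD.bdd_mul (c := C) hf.aestronglyMeasurable (Eventually.of_forall hC)
    exact this.congr (Eventually.of_forall fun x => mul_comm _ _)
  have e2 : |(∫ x in D, u x * φ x) - ∫ x in D, u x * ψ x| ≤ C₂ * δ := by
    rw [← integral_sub (int φ hφ.continuous hφc) (int ψ hψ.continuous hc), ← Real.norm_eq_abs,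
      ← integral_mul_const]
    refine norm_integral_le_of_norm_le (huD.abs.mul_const δ) (Eventually.of_forall fun x => ?_)
    rw [← mul_sub, Real.norm_eq_abs, abs_mul]
    exact mul_le_mul_of_nonneg_left (hφ0 x) (abs_nonneg _)
  have e3 := abs_sources_integral_sub_le hS hφ.continuous hφc hψ.continuous hc hφ0
  have e4 : (∫ x, greenFlux q u ψ x)
      - (c * (∫ x in D, u x * ψ x) + χ * S.integral (fun x => u x * ψ x))
      = ((∫ x, greenFlux q u ψ x) - ∫ x, greenFlux q u φ x)
        + c * ((∫ x in D, u x * φ x) - ∫ x in D, u x * ψ x)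
        + χ * (S.integral (fun x => u x * φ x) - S.integral (fun x => u x * ψ x)) := by
    rw [key]; ring
  rw [e4]
  calc _ ≤ _ := abs_add_three _ _ _
    _ ≤ C₁ * δ + |c| * (C₂ * δ) + |χ| * (C₃ * δ) := by
      rw [abs_mul, abs_mul]; gcongr
    _ = _ := by ring

/-! ### Sublevel sets of a function without critical points on its zero level -/

section Sublevel

variable {G : Plane → ℝ}

lemma eventually_lt_zero_of_fderiv_neg (hG : ContDiff ℝ 1 G) {x v : Plane} (hx : G x = 0)
    (hv : fderiv ℝ G x v < 0) : ∀ᶠ t : ℝ in 𝓝[>] 0, G (x + t • v) < 0 := by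
  have hd : HasDerivAt (fun t : ℝ => G (x + t • v)) (fderiv ℝ G x v) 0 := by
    have h1 : HasDerivAt (fun t : ℝ => x + t • v) v 0 := by
      simpa using ((hasDerivAt_id (0 : ℝ)).smul_const v).const_add x
    have h2 : HasFDerivAt G (fderiv ℝ G x) (x + (0 : ℝ) • v) := by
      simpa using ((hG.differentiable one_ne_zero) x).hasFDerivAt
    exact h2.comp_hasDerivAt 0 h1
  have hs := hd.tendsto_slope_zero_right
  filter_upwards [hs.eventually (gt_mem_nhds hv), self_mem_nhdsWithin] with t h1 (h2 : 0 < t)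
  simp only [zero_add, zero_smul, add_zero, hx, sub_zero, smul_eq_mul] at h1
  by_contra h
  have : 0 ≤ t⁻¹ * G (x + t • v) := mul_nonneg (inv_nonneg.2 h2.le) (not_lt.1 h)
  linarith

lemma exists_fderiv_neg {x : Plane} (h : fderiv ℝ G x ≠ 0) : ∃ v, fderiv ℝ G x v < 0 := by
  by_contra! hcon
  refine h (ContinuousLinearMap.ext fun v => ?_)
  have h1 := hcon v
  have h2 := hcon (-v)
  rw [map_neg] at h2
  exact le_antisymm (neg_nonneg.1 h2) h1

lemma mem_closure_sublevel (hG : ContDiff ℝ 1 G) {x : Plane} (hx : G x = 0)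
    (h : fderiv ℝ G x ≠ 0) : x ∈ closure {y | G y < 0} := by
  obtain ⟨v, hv⟩ := exists_fderiv_neg h
  have ht : Tendsto (fun t : ℝ => x + t • v) (𝓝[>] 0) (𝓝 x) := by
    have : Tendsto (fun t : ℝ => x + t • v) (𝓝 0) (𝓝 (x + (0 : ℝ) • v)) :=
      (continuous_const.add (continuous_id.smul continuous_const)).tendsto 0
    rw [zero_smul, add_zero] at this
    exact this.mono_left nhdsWithin_le_nhds
  exact mem_closure_of_tendsto ht (eventually_lt_zero_of_fderiv_neg hG hx hv)

lemma le_zero_of_mem_closure_sublevel (hG : Continuous G) {x : Plane}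
    (hx : x ∈ closure {y | G y < 0}) : G x ≤ 0 :=
  closure_minimal (fun _ h => le_of_lt h) (isClosed_le hG continuous_const) hx

lemma frontier_sublevel (hG : ContDiff ℝ 1 G) (hreg : ∀ x, G x = 0 → fderiv ℝ G x ≠ 0) :
    frontier {y | G y < 0} = {y | G y = 0} := by
  refine Subset.antisymm (frontier_lt_subset_eq hG.continuous continuous_const) fun x hx => ?_
  rw [(isOpen_lt hG.continuous continuous_const).frontier_eq]
  refine ⟨mem_closure_sublevel hG hx (hreg x hx), fun h : G x < 0 => ?_⟩
  rw [show G x = 0 from hx] at h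
  exact lt_irrefl _ h

/-- The tangent cone contains the open half-plane of directions in which `G` decreases, and this
spans the plane. It makes the derivative within the closed domain continuous up to the interface. -/
lemma uniqueDiffWithinAt_closure_sublevel (hG : ContDiff ℝ 1 G) {x : Plane} (hx : G x = 0)
    (h : fderiv ℝ G x ≠ 0) : UniqueDiffWithinAt ℝ (closure {y | G y < 0}) x := by
  have hcone : ∀ v, fderiv ℝ G x v < 0 → v ∈ tangentConeAt ℝ (closure {y | G y < 0}) x := by
    intro v hv
    refine mem_tangentConeAt_of_seq (𝓝[>] (0 : ℝ)) (fun t => t⁻¹) (fun t => t • v) ?_ ?_ ?_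
    · have : Tendsto (fun t : ℝ => t • v) (𝓝 0) (𝓝 ((0 : ℝ) • v)) :=
        (continuous_id.smul continuous_const).tendsto 0
      rw [zero_smul] at this
      exact this.mono_left nhdsWithin_le_nhds
    · exact (eventually_lt_zero_of_fderiv_neg hG hx hv).mono fun t ht => subset_closure ht
    · refine tendsto_const_nhds.congr' ?_
      filter_upwards [self_mem_nhdsWithin] with t (ht : 0 < t)
      rw [smul_smul, inv_mul_cancel₀ ht.ne', one_smul]
  refine ⟨?_, subset_closure (mem_closure_sublevel hG hx h)⟩
  obtain ⟨v, hv⟩ := exists_fderiv_neg h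
  have htop : (Submodule.span ℝ (tangentConeAt ℝ (closure {y | G y < 0}) x) : Set Plane)
      = univ := by
    refine eq_univ_of_forall fun w => ?_
    -- With this `s` the derivative of `G` along `w + s • v` is `DG(w) - |DG(w)| - 1 < 0`, so `w` is
    -- a difference of two vectors in the span of the cone.
    set s := (|fderiv ℝ G x w| + 1) / (-fderiv ℝ G x v)
    have hs : fderiv ℝ G x (w + s • v) < 0 := by
      have : s * fderiv ℝ G x v = -(|fderiv ℝ G x w| + 1) := by
        rw [show s = (|fderiv ℝ G x w| + 1) / (-fderiv ℝ G x v) from rfl, div_neg, neg_mul,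
          div_mul_cancel₀ _ hv.ne]
      rw [map_add, map_smul, smul_eq_mul, this]
      linarith [le_abs_self (fderiv ℝ G x w)]
    have e : w = (w + s • v) - s • v := by abel
    rw [SetLike.mem_coe, e]
    exact Submodule.sub_mem _ (Submodule.subset_span (hcone _ hs))
      (Submodule.smul_mem _ _ (Submodule.subset_span (hcone v hv)))
  rw [htop]
  exact dense_univ

lemma uniqueDiffOn_closure_sublevel_inter (hG : ContDiff ℝ 1 G)
    (hreg : ∀ x, G x = 0 → fderiv ℝ G x ≠ 0) {N : Set Plane} (hN : IsOpen N) :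
    UniqueDiffOn ℝ (closure {y | G y < 0} ∩ N) := by
  intro x hx
  refine UniqueDiffWithinAt.inter ?_ (hN.mem_nhds hx.2)
  rcases (le_zero_of_mem_closure_sublevel hG.continuous hx.1).lt_or_eq with h | h
  · exact ((isOpen_lt hG.continuous continuous_const).uniqueDiffWithinAt
      (show x ∈ {y | G y < 0} from h)).mono subset_closure
  · exact uniqueDiffWithinAt_closure_sublevel hG h (hreg x h)

lemma hasCompactSupport_stepDown_comp {K : Set Plane} (hK : IsCompact K)
    {ε : ℝ} (hε : 0 < ε) (h : ∀ x, G x ≤ -ε → x ∈ K) :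
    HasCompactSupport fun x => stepDown ε (G x) :=
  HasCompactSupport.intro hK fun x hx =>
    stepDown_eq_zero hε (le_of_lt (not_le.1 fun hle => hx (h x hle)))

lemma tsupport_stepDown_comp_subset (hG : Continuous G) {ε : ℝ} (hε : 0 < ε) :
    tsupport (fun x => stepDown ε (G x)) ⊆ {x | G x ≤ -ε} :=
  closure_minimal (fun x hx => by
    by_contra h
    exact hx (stepDown_eq_zero hε (le_of_lt (not_le.1 h)))) (isClosed_le hG continuous_const)

lemma tsupport_fderiv_stepDown_comp_subset (hG : ContDiff ℝ 1 G) {ε : ℝ} (hε : 0 < ε) :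
    tsupport (fderiv ℝ fun x => stepDown ε (G x)) ⊆ {x | -2 * ε ≤ G x ∧ G x ≤ -ε} :=
  closure_minimal (fun x hx => by
    rw [Function.mem_support, fderiv_stepDown_comp hG] at hx
    constructor
    · by_contra h
      exact hx (by rw [deriv_stepDown_eq_zero_of_gt hε (not_le.1 h), zero_smul])
    · by_contra h
      exact hx (by rw [deriv_stepDown_eq_zero_of_lt hε (not_le.1 h), zero_smul]))
    ((isClosed_le continuous_const hG.continuous).inter
      (isClosed_le hG.continuous continuous_const))

lemma gradient_stepDown_comp (hG : ContDiff ℝ 1 G) (ε : ℝ) (x : Plane) :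
    gradient (fun y => stepDown ε (G y)) x = deriv (stepDown ε) (G x) • gradient G x := by
  rw [gradient, fderiv_stepDown_comp hG, map_smul]
  rfl

/-- Smooth cutoffs approximate the integral over the part of a set where `G < 0`. -/
lemma tendsto_setIntegral_stepDown_mul (hG : Continuous G) {V : Set Plane}
    (hV : {x | G x < 0} ⊆ V) (hVm : MeasurableSet V) {f : Plane → ℝ} (hf : IntegrableOn f V) :
    Tendsto (fun ε => ∫ x in V, stepDown ε (G x) * f x) (𝓝[>] 0)
      (𝓝 (∫ x in {x | G x < 0}, f x)) := by
  have hm : MeasurableSet {x | G x < 0} := (isOpen_lt hG continuous_const).measurableSet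
  have e : ∫ x in {x | G x < 0}, f x
      = ∫ x in V, (Iio (0 : ℝ)).indicator 1 (G x) * f x := by
    rw [← inter_eq_self_of_subset_right hV, ← setIntegral_indicator hm]
    refine setIntegral_congr_fun hVm fun x _ => ?_
    by_cases h : G x < 0
    · simp [indicator, h]
    · simp [indicator, h]
  rw [e]
  refine tendsto_integral_filter_of_dominated_convergence (fun x => |f x|)
    (Eventually.of_forall fun ε => ?_) (Eventually.of_forall fun ε =>
      Eventually.of_forall fun x => ?_) hf.abs
    (Eventually.of_forall fun x => (tendsto_stepDown (G x)).mul_const (f x))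
  · exact (((contDiff_stepDown ε).continuous.comp hG).aestronglyMeasurable).mul
      hf.aestronglyMeasurable
  · rw [Real.norm_eq_abs, abs_mul, abs_of_nonneg (stepDown_nonneg _ _)]
    exact mul_le_of_le_one_left (abs_nonneg _) (stepDown_le_one _ _)

end Sublevel

/-! ### The flux of the pressure gradient through the interface -/

/-- If `k ∇q · ∇G = a` on `{G = 0}`, where `q` vanishes, and if the flux of `-Y` through this
curve approximates that of `u a`, then the integral of `div Y` over `{G < 0}` approximates
what Green's identity predicts. -/
theorem abs_flux_sub_integral_divergence_le {G a q u : Plane → ℝ} {X Y : Plane → Plane}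
    {N : Set Plane} {c χ k η : ℝ} {S : Sources}
    (hG : ContDiff ℝ 1 G) (hreg : ∀ x, G x = 0 → fderiv ℝ G x ≠ 0)
    (hb : Bornology.IsBounded {x | G x < 0}) (hN : IsOpen N) (hΓN : {x | G x = 0} ⊆ N)
    (hp : ∀ φ : Plane → ℝ, ContDiff ℝ ∞ φ → HasCompactSupport φ → tsupport φ ⊆ {x | G x < 0} →
      ∫ x in {x | G x < 0}, q x * (Δ φ) x = c * (∫ x in {x | G x < 0}, φ x) + χ * S.integral φ)
    (hq : ContDiffOn ℝ 1 q (closure {x | G x < 0} ∩ N)) (hq0 : ∀ x, G x = 0 → q x = 0)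
    (hqn : ∀ x, G x = 0 → k * fderivWithin ℝ q (closure {x | G x < 0}) x (gradient G x) = a x)
    (hu : ∀ x ∈ closure {x | G x < 0}, HarmonicAt u x)
    (hS : IntegrableOn (fun x => u x * S.density x) S.cut μH[1])
    (hScut : MeasurableSet S.cut) (hScpt : IsCompact S.support)
    (hSsub : S.support ⊆ {x | G x < 0})
    (hη : 0 ≤ η) (hX : ContDiff ℝ 1 X) (hXc : HasCompactSupport X) (hY : ContDiff ℝ 1 Y)
    (hX1 : ∀ x, G x = 0 → 1 < fderiv ℝ G x (X x))
    (hY1 : ∀ x, G x = 0 → |u x * a x + fderiv ℝ G x (Y x)| < η) :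
    |-k * (c * (∫ x in {x | G x < 0}, u x) + χ * S.integral u)
      - ∫ x in {x | G x < 0}, divergence Y x| ≤ η * ∫ x, |divergence X x| := by
  set Ω := {x | G x < 0} with hΩ
  have hΩo : IsOpen Ω := isOpen_lt hG.continuous continuous_const
  have hΩm : MeasurableSet Ω := hΩo.measurableSet
  have hcpt : IsCompact (closure Ω) := hb.isCompact_closure
  have hcG : Continuous (fderiv ℝ G) := hG.continuous_fderiv one_ne_zero
  have hu1 : ∀ x ∈ closure Ω, ContDiffAt ℝ 1 u x := fun x hx =>
    (contDiffAt_of_harmonicAt (hu x hx)).of_le (by norm_cast)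
  have huc : ContinuousOn u (closure Ω) := fun x hx =>
    (hu1 x hx).continuousAt.continuousWithinAt
  have huΩ : IntegrableOn u Ω := (huc.integrableOn_compact hcpt).mono_set subset_closure
  have hYΩ : IntegrableOn (divergence Y) Ω :=
    ((continuous_divergence hY).continuousOn.integrableOn_compact hcpt).mono_set subset_closure
  have hqd : ContinuousOn (fderivWithin ℝ q (closure Ω)) (closure Ω ∩ N) := by
    refine (hq.continuousOn_fderivWithin (uniqueDiffOn_closure_sublevel_inter hG hreg hN)
      le_rfl).congr fun x hx => ?_
    exact (fderivWithin_inter (hN.mem_nhds hx.2)).symm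
  -- Since `∇(β_ε ∘ G) = β_ε'(G) ∇G`, the Green flux of the cutoff times `-k` is `β_ε'(G) A`. On the
  -- interface `q = 0` and `A` reduces to `u a`; by continuity up to the boundary, `A` stays close
  -- to `-∇G · Y` in a thin inner layer.
  set A : Plane → ℝ := fun x => -k * (q x * fderiv ℝ u x (gradient G x)
    - u x * fderivWithin ℝ q (closure Ω) x (gradient G x)) with hA
  have hnear : ∀ x ∈ closure Ω, G x = 0 →
      ∀ᶠ y in 𝓝[closure Ω] x, |A y + fderiv ℝ G y (Y y)| < η * fderiv ℝ G y (X y) := by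
    intro x hx hGx
    have hηpos : 0 < η := (abs_nonneg _).trans_lt (hY1 x hGx)
    have hlt : |A x + fderiv ℝ G x (Y x)| < η * fderiv ℝ G x (X x) := by
      have hAx : A x = u x * a x := by
        rw [hA]
        simp only [hq0 x hGx, ← hqn x hGx]
        ring
      rw [hAx]
      exact (hY1 x hGx).trans (lt_mul_of_one_lt_right hηpos (hX1 x hGx))
    have hNx : N ∈ 𝓝 x := hN.mem_nhds (hΓN hGx)
    have cg : ContinuousWithinAt (gradient G) (closure Ω ∩ N) x :=
      (continuous_gradient hG).continuousWithinAt
    have cq : ContinuousWithinAt q (closure Ω ∩ N) x := hq.continuousOn x ⟨hx, hΓN hGx⟩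
    have cu : ContinuousWithinAt u (closure Ω ∩ N) x := (hu1 x hx).continuousAt.continuousWithinAt
    have cdu : ContinuousWithinAt (fderiv ℝ u) (closure Ω ∩ N) x :=
      ((hu1 x hx).continuousAt_fderiv one_ne_zero).continuousWithinAt
    have cA : ContinuousWithinAt A (closure Ω ∩ N) x :=
      continuousWithinAt_const.mul ((cq.mul (cdu.clm_apply cg)).sub
        (cu.mul ((hqd x ⟨hx, hΓN hGx⟩).clm_apply cg)))
    have cY : Continuous fun y => fderiv ℝ G y (Y y) := hcG.clm_apply hY.continuous
    have cX : Continuous fun y => η * fderiv ℝ G y (X y) :=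
      continuous_const.mul (hcG.clm_apply hX.continuous)
    have := (cA.add cY.continuousWithinAt).abs.eventually_lt cX.continuousWithinAt hlt
    rwa [nhdsWithin_inter_of_mem' (mem_nhdsWithin_of_mem_nhds hNx)] at this
  obtain ⟨m₁, hm₁, h₁⟩ := exists_forall_abs_lt_of_eventually hcpt hG.continuous hnear
  obtain ⟨m₂, hm₂, h₂⟩ := exists_forall_abs_lt_of_eventually hcpt hG.continuous
    (P := fun x => x ∈ N) fun x _ hGx => mem_nhdsWithin_of_mem_nhds (hN.mem_nhds (hΓN hGx))
  -- With the property `False` this says `|G| ≥ m₃` on the compact support of the sources, so for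
  -- small `ε` the cutoff equals `1` there.
  obtain ⟨m₃, hm₃, h₃⟩ := exists_forall_abs_lt_of_eventually hScpt hG.continuous
    (P := fun _ => False) fun x hx hGx => absurd hGx (ne_of_lt (hSsub hx))
  have hev : ∀ᶠ ε in 𝓝[>] (0 : ℝ),
      |-k * (c * (∫ x in Ω, stepDown ε (G x) * u x) + χ * S.integral u)
        - ∫ x in Ω, stepDown ε (G x) * divergence Y x| ≤ η * ∫ x, |divergence X x| := by
    filter_upwards [self_mem_nhdsWithin, mem_nhdsWithin_of_mem_nhds (Iio_mem_nhds
      (show 0 < min (min m₁ m₂) m₃ / 2 by positivity))] with ε (hε : 0 < ε) hε'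
    have hεm : 2 * ε < min (min m₁ m₂) m₃ := by rw [mem_Iio] at hε'; linarith
    have hε₁ : 2 * ε < m₁ := hεm.trans_le ((min_le_left _ _).trans (min_le_left _ _))
    have hε₂ : 2 * ε < m₂ := hεm.trans_le ((min_le_left _ _).trans (min_le_right _ _))
    have hε₃ : 2 * ε < m₃ := hεm.trans_le (min_le_right _ _)
    have hneg : ∀ x, G x ≤ -ε → x ∈ Ω := fun x hx => by
      rw [hΩ, mem_ofPred_eq]; linarith
    set ψ : Plane → ℝ := fun x => stepDown ε (G x) with hψdef
    have hψ : ContDiff ℝ 1 ψ := contDiff_stepDown_comp hG ε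
    have hψc : HasCompactSupport ψ :=
      hasCompactSupport_stepDown_comp hcpt hε fun x hx => subset_closure (hneg x hx)
    have hψΩ : tsupport ψ ⊆ Ω := fun x hx =>
      hneg x (tsupport_stepDown_comp_subset hG.continuous hε hx)
    have hψN : tsupport (fderiv ℝ ψ) ⊆ N := fun x hx => by
      have hx' := tsupport_fderiv_stepDown_comp_subset hG hε hx
      refine h₂ x (subset_closure (hneg x hx'.2)) (abs_lt.2 ⟨?_, ?_⟩)
      · linarith [hx'.1]
      · linarith [hx'.2]
    have hqo : ContDiffOn ℝ 1 q (Ω ∩ N) := hq.mono (inter_subset_inter_left _ subset_closure)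
    have green := integral_greenFlux hΩo hN hp hqo (fun x hx => hu x (subset_closure hx)) huΩ hS
      hψ hψc hψΩ hψN
    have hSψ : S.integral (fun x => u x * ψ x) = S.integral u := by
      have h1 : ∀ x ∈ S.support, ψ x = 1 := fun x hx => by
        refine stepDown_eq_one hε ?_
        have h2 : ¬|G x| < m₃ := fun h => h₃ x hx h
        rw [abs_of_neg (hSsub hx)] at h2
        linarith
      rw [Sources.integral, Sources.integral]
      congr 1
      · refine setIntegral_congr_fun hScut fun x hx => ?_
        simp only [h1 x (Or.inl hx), mul_one]
      · exact Finset.sum_congr rfl fun x hx => by rw [h1 x (Or.inr hx), mul_one]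
    have hpt : ∀ x, -k * greenFlux q u ψ x = deriv (stepDown ε) (G x) * A x := fun x => by
      by_cases hx : x ∈ Ω
      · have e := fderivWithin_of_mem_nhds (𝕜 := ℝ) (f := q)
          (mem_of_superset (hΩo.mem_nhds hx) (subset_closure (s := Ω)))
        rw [greenFlux, gradient_stepDown_comp hG]
        simp only [hA, e, map_smul, smul_eq_mul]
        ring
      · have h0 : deriv (stepDown ε) (G x) = 0 :=
          deriv_stepDown_eq_zero_of_lt hε (not_le.1 fun h => hx (hneg x h))
        rw [greenFlux, gradient_stepDown_comp hG, h0]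
        simp
    have hu1' : ContDiffOn ℝ 1 u (Ω ∩ N) := fun x hx =>
      (hu1 x (subset_closure hx.1)).contDiffWithinAt
    have iA : Integrable fun x => deriv (stepDown ε) (G x) * A x := by
      refine Integrable.congr ?_ (Eventually.of_forall hpt)
      refine Integrable.const_mul ?_ _
      exact (continuous_greenFlux (hΩo.inter hN) hqo hu1' hψ (subset_inter
        ((tsupport_fderiv_subset ℝ).trans hψΩ) hψN)).integrable_of_hasCompactSupport
        (hasCompactSupport_greenFlux hψc)
    have core := abs_integral_deriv_stepDown_sub_le hε hη hG hX hY hXc hψc iA fun x hx1 hx2 => by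
      refine (h₁ x (subset_closure (hneg x hx2)) (abs_lt.2 ⟨?_, ?_⟩)).le
      · linarith
      · linarith
    have e1 : ∫ x, deriv (stepDown ε) (G x) * A x
        = -k * (c * (∫ x in Ω, stepDown ε (G x) * u x) + χ * S.integral u) := by
      simp_rw [← hpt]
      rw [integral_const_mul, green, hSψ]
      simp only [hψdef, mul_comm (u _)]
    have e2 : ∫ x in Ω, stepDown ε (G x) * divergence Y x
        = ∫ x, stepDown ε (G x) * divergence Y x :=
      setIntegral_eq_integral_of_forall_compl_eq_zero fun x hx => by
        rw [stepDown_eq_zero hε (not_le.1 fun h => hx (hneg x h)).le, zero_mul]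
    rwa [e1, ← e2] at core
  have t1 := tendsto_setIntegral_stepDown_mul hG.continuous (V := Ω) subset_rfl hΩm huΩ
  have t2 := tendsto_setIntegral_stepDown_mul hG.continuous (V := Ω) subset_rfl hΩm hYΩ
  exact le_of_tendsto
    (((((t1.const_mul c).add_const (χ * S.integral u)).const_mul (-k)).sub t2).abs) hev

/-! ### Differentiation of an integral over a moving domain -/

lemma divergence_const_smul {Y : Plane → Plane} (hY : ContDiff ℝ 1 Y) (τ : ℝ) (x : Plane) :
    divergence (fun y => τ • Y y) x = τ * divergence Y x := by
  rw [divergence, divergence, Finset.mul_sum]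
  refine Finset.sum_congr rfl fun i _ => ?_
  have h := (((contDiff_component hY i).differentiable one_ne_zero) x).hasFDerivAt.const_mul τ
  have e : (fun y => (τ • Y y) i) = fun y => τ * Y y i := rfl
  rw [e, h.fderiv]
  simp

/-- The change of a smoothed integral over `{G < 0}` when `G` is replaced by `G + d`. -/
theorem abs_integral_stepDown_add_sub_le {G d u : Plane → ℝ} {X Y : Plane → Plane}
    {V : Set Plane} {ε η η' τ I : ℝ} (hε : 0 < ε) (hη : 0 ≤ η)
    (hG : ContDiff ℝ 1 G) (hd : ContDiff ℝ 1 d)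
    (hV : IsCompact (closure V)) (hu : ContinuousOn u (closure V))
    (hX : ContDiff ℝ 1 X) (hXc : HasCompactSupport X) (hY : ContDiff ℝ 1 Y)
    (h0 : ∀ x ∉ V, 0 ≤ G x) (h1 : ∀ x ∉ V, 0 ≤ G x + d x)
    (hb : ∀ θ ∈ Icc (0 : ℝ) 1, ∀ x ∈ V, -2 * ε ≤ G x + θ * d x → G x + θ * d x ≤ -ε →
      |d x * u x + τ * fderiv ℝ (fun y => G y + θ * d y) x (Y x)|
        ≤ |τ| * η * fderiv ℝ (fun y => G y + θ * d y) x (X x))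
    (hI : ∀ θ ∈ Icc (0 : ℝ) 1,
      |(∫ x, stepDown ε (G x + θ * d x) * divergence Y x) - I| ≤ η') :
    |(∫ x in V, stepDown ε (G x + d x) * u x) - (∫ x in V, stepDown ε (G x) * u x) - τ * I|
      ≤ |τ| * (η * (∫ x, |divergence X x|) + η') := by
  -- Linear interpolation at fixed `ε`: the `θ`-derivative of `∫ β_ε(H θ) u` is `∫ β_ε'(H θ) d u`.
  -- The flux comparison with the field `τ Y` makes this close to `τ I`, and the mean value
  -- inequality on `[0, 1]` integrates the bound.
  set H : ℝ → Plane → ℝ := fun θ x => G x + θ * d x with hH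
  have hHc : ∀ θ, ContDiff ℝ 1 (H θ) := fun θ => hG.add (contDiff_const.mul hd)
  have hHV : ∀ θ ∈ Icc (0 : ℝ) 1, ∀ x ∉ V, 0 ≤ H θ x := fun θ hθ x hx => by
    have e : H θ x = (1 - θ) * G x + θ * (G x + d x) := by simp only [hH]; ring
    rw [e]
    exact add_nonneg (mul_nonneg (by linarith [hθ.2]) (h0 x hx)) (mul_nonneg hθ.1 (h1 x hx))
  have iu : IntegrableOn u V := (hu.integrableOn_compact hV).mono_set subset_closure
  have idu : IntegrableOn (fun x => d x * u x) V :=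
    ((hd.continuous.continuousOn.mul hu).integrableOn_compact hV).mono_set subset_closure
  obtain ⟨C, hC0, hC⟩ := exists_abs_deriv_stepDown_le hε
  have cβ : Continuous (stepDown ε) := (contDiff_stepDown ε).continuous
  have cβ' := continuous_deriv_stepDown ε
  have iF : ∀ θ, IntegrableOn (fun x => stepDown ε (H θ x) * u x) V := fun θ => by
    refine iu.bdd_mul (c := 1) (cβ.comp (hHc θ).continuous).aestronglyMeasurable
      (Eventually.of_forall fun x => ?_)
    rw [Real.norm_eq_abs, abs_of_nonneg (stepDown_nonneg _ _)]
    exact stepDown_le_one _ _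
  have iF' : ∀ θ, IntegrableOn (fun x => deriv (stepDown ε) (H θ x) * (d x * u x)) V := fun θ =>
    idu.bdd_mul (c := C) (cβ'.comp (hHc θ).continuous).aestronglyMeasurable
      (Eventually.of_forall fun x => hC _)
  have hder : ∀ θ, HasDerivAt (fun θ => ∫ x in V, stepDown ε (H θ x) * u x)
      (∫ x in V, deriv (stepDown ε) (H θ x) * (d x * u x)) θ := fun θ => by
    refine (hasDerivAt_integral_of_dominated_loc_of_deriv_le
      (F := fun θ x => stepDown ε (H θ x) * u x)
      (F' := fun θ x => deriv (stepDown ε) (H θ x) * (d x * u x))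
      (bound := fun x => C * |d x * u x|) univ_mem
      (Eventually.of_forall fun θ => (iF θ).aestronglyMeasurable) (iF θ)
      (iF' θ).aestronglyMeasurable (Eventually.of_forall fun x θ _ => ?_)
      (idu.abs.const_mul C) (Eventually.of_forall fun x θ _ => ?_)).2
    · rw [Real.norm_eq_abs, abs_mul]
      exact mul_le_mul_of_nonneg_right (hC _) (abs_nonneg _)
    · have h1 : HasDerivAt (fun θ => H θ x) (d x) θ := by
        have h := ((hasDerivAt_id θ).mul_const (d x)).const_add (G x)
        rwa [one_mul] at h
      have h2 := (((contDiff_stepDown ε).differentiable (by simp)) (H θ x)).hasDerivAt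
      have h3 := (h2.comp θ h1).mul_const (u x)
      simpa only [mul_assoc, Function.comp_def] using h3
  have hbound : ∀ θ ∈ Icc (0 : ℝ) 1,
      |(∫ x in V, deriv (stepDown ε) (H θ x) * (d x * u x)) - τ * I|
        ≤ |τ| * (η * (∫ x, |divergence X x|) + η') := by
    intro θ hθ
    have hout : ∀ x ∉ V, deriv (stepDown ε) (H θ x) * (d x * u x) = 0 := fun x hx => by
      rw [deriv_stepDown_eq_zero_of_lt hε (by linarith [hHV θ hθ x hx]), zero_mul]
    have hcs : HasCompactSupport fun x => stepDown ε (H θ x) :=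
      hasCompactSupport_stepDown_comp hV hε fun x hx => by
        by_contra h
        linarith [hHV θ hθ x fun h' => h (subset_closure h')]
    have iA : Integrable fun x => deriv (stepDown ε) (H θ x) * (d x * u x) :=
      (iF' θ).integrable_of_forall_notMem_eq_zero hout
    have core := abs_integral_deriv_stepDown_sub_le (A := fun x => d x * u x)
      (Y := fun y => τ • Y y) hε (mul_nonneg (abs_nonneg τ) hη) (hHc θ) hX
      (hY.const_smul τ) hXc hcs iA fun x hx1 hx2 => by
        have hxV : x ∈ V := by
          by_contra h
          linarith [hHV θ hθ x h]
        rw [map_smul, smul_eq_mul]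
        exact hb θ hθ x hxV hx1 hx2
    have e : ∫ x, stepDown ε (H θ x) * divergence (fun y => τ • Y y) x
        = τ * ∫ x, stepDown ε (H θ x) * divergence Y x := by
      rw [← integral_const_mul]
      congr 1
      ext x
      rw [divergence_const_smul hY]
      ring
    rw [e] at core
    rw [setIntegral_eq_integral_of_forall_compl_eq_zero hout]
    calc _ = |((∫ x, deriv (stepDown ε) (H θ x) * (d x * u x))
            - τ * ∫ x, stepDown ε (H θ x) * divergence Y x)
          + τ * ((∫ x, stepDown ε (H θ x) * divergence Y x) - I)| := by congr 1; ring
      _ ≤ |τ| * η * (∫ x, |divergence X x|) + |τ| * η' := by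
          refine (abs_add_le _ _).trans (add_le_add core ?_)
          rw [abs_mul]
          exact mul_le_mul_of_nonneg_left (hI θ hθ) (abs_nonneg _)
      _ = _ := by ring
  have mvt := norm_image_sub_le_of_norm_deriv_le_segment_01'
    (f := fun θ => (∫ x in V, stepDown ε (H θ x) * u x) - θ * (τ * I))
    (fun θ _ => ((hder θ).sub ((hasDerivAt_id θ).mul_const (τ * I))).hasDerivWithinAt)
    (fun θ hθ => by
      rw [one_mul]
      exact hbound θ (Ico_subset_Icc_self hθ))
  have e : (∫ x in V, stepDown ε (G x + d x) * u x) - (∫ x in V, stepDown ε (G x) * u x) - τ * I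
      = ((∫ x in V, stepDown ε (H 1 x) * u x) - 1 * (τ * I))
        - ((∫ x in V, stepDown ε (H 0 x) * u x) - 0 * (τ * I)) := by
    simp only [hH, one_mul, zero_mul, add_zero, sub_zero]
    ring
  rw [e]
  exact mvt

/-- Integrals over thin neighbourhoods of a null level set are small. -/
lemma exists_setIntegral_nearLevel_le {G f : Plane → ℝ} (hG : Continuous G) {V : Set Plane}
    (hV : MeasurableSet V) (hf : IntegrableOn f V) (h0 : volume {x | G x = 0} = 0)
    {η : ℝ} (hη : 0 < η) : ∃ m > 0, ∫ x in V ∩ {x | |G x| ≤ m}, |f x| ≤ η := by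
  have hm : ∀ m : ℝ, MeasurableSet (V ∩ {x | |G x| ≤ m}) := fun m =>
    hV.inter (isClosed_le hG.abs continuous_const).measurableSet
  have ht := tendsto_setIntegral_of_antitone (μ := volume) (f := fun x => |f x|)
    (s := fun n : ℕ => V ∩ {x | |G x| ≤ 1 / ((n : ℝ) + 1)}) (fun n => hm _)
    (fun a b hab => inter_subset_inter_right _ fun x (hx : |G x| ≤ _) =>
      hx.trans (Nat.one_div_le_one_div hab)) ⟨0, (hf.mono_set inter_subset_left).abs⟩
  have hz : ∫ x in ⋂ n : ℕ, V ∩ {x | |G x| ≤ 1 / ((n : ℝ) + 1)}, |f x| = 0 := by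
    refine setIntegral_measure_zero _ (measure_mono_null (fun x hx => ?_) h0)
    have h1 : ∀ n : ℕ, |G x| ≤ 1 / ((n : ℝ) + 1) := fun n => (mem_iInter.1 hx n).2
    have h2 : |G x| ≤ 0 := ge_of_tendsto tendsto_one_div_add_atTop_nhds_zero_nat
      (Eventually.of_forall h1)
    exact abs_nonpos_iff.1 h2
  rw [hz] at ht
  obtain ⟨n, hn⟩ := (ht.eventually (gt_mem_nhds hη)).exists
  exact ⟨1 / ((n : ℝ) + 1), by positivity, hn.le⟩

/-- Where `|G| > m` in `V`, the condition `2ε + r ≤ m` makes the cutoff of `H` agree with the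
indicator of `{G < 0}`; in the remaining layer the two differ by at most `1`. -/
lemma abs_integral_stepDown_sub_setIntegral_le {G H f : Plane → ℝ} {V : Set Plane} {ε r m : ℝ}
    (hε : 0 < ε) (hG : Continuous G) (hH : Continuous H) (hVm : MeasurableSet V)
    (hf : IntegrableOn f V) (h0 : ∀ x ∉ V, 0 ≤ G x) (h1 : ∀ x ∉ V, 0 ≤ H x)
    (hd : ∀ x ∈ V, |H x - G x| ≤ r) (hm : 2 * ε + r ≤ m) :
    |(∫ x, stepDown ε (H x) * f x) - ∫ x in {x | G x < 0}, f x|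
      ≤ ∫ x in V ∩ {x | |G x| ≤ m}, |f x| := by
  have hGm : MeasurableSet {x | G x < 0} := (isOpen_lt hG continuous_const).measurableSet
  have hLm : MeasurableSet {x | |G x| ≤ m} :=
    (isClosed_le hG.abs continuous_const).measurableSet
  have hsub : {x | G x < 0} ⊆ V := fun x hx => by
    by_contra h
    exact absurd (h0 x h) (not_le.2 hx)
  have e1 : ∫ x, stepDown ε (H x) * f x = ∫ x in V, stepDown ε (H x) * f x :=
    (setIntegral_eq_integral_of_forall_compl_eq_zero fun x hx => by
      rw [stepDown_eq_zero hε (by linarith [h1 x hx]), zero_mul]).symm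
  have e2 : ∫ x in {x | G x < 0}, f x = ∫ x in V, ({x | G x < 0} : Set Plane).indicator f x := by
    rw [setIntegral_indicator hGm, inter_eq_self_of_subset_right hsub]
  have i1 : IntegrableOn (fun x => stepDown ε (H x) * f x) V := by
    refine hf.bdd_mul (c := 1)
      ((contDiff_stepDown ε).continuous.comp hH).aestronglyMeasurable
      (Eventually.of_forall fun x => ?_)
    rw [Real.norm_eq_abs, abs_of_nonneg (stepDown_nonneg _ _)]
    exact stepDown_le_one _ _
  have i2 : IntegrableOn (({x | G x < 0} : Set Plane).indicator f) V := hf.indicator hGm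
  rw [e1, e2, ← integral_sub i1 i2, ← setIntegral_indicator hLm, ← Real.norm_eq_abs]
  refine norm_integral_le_of_norm_le (hf.abs.indicator hLm)
    ((ae_restrict_iff' hVm).2 (Eventually.of_forall fun x hx => ?_))
  have hdx := abs_le.1 (hd x hx)
  rw [Real.norm_eq_abs]
  by_cases hL : |G x| ≤ m
  · rw [indicator_of_mem (show x ∈ {x | |G x| ≤ m} from hL)]
    have b0 := stepDown_nonneg ε (H x)
    have b1 := stepDown_le_one ε (H x)
    by_cases hneg : G x < 0
    · rw [indicator_of_mem (show x ∈ {x | G x < 0} from hneg),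
        show stepDown ε (H x) * f x - f x = (stepDown ε (H x) - 1) * f x by ring, abs_mul]
      exact mul_le_of_le_one_left (abs_nonneg _) (abs_le.2 ⟨by linarith, by linarith⟩)
    · rw [indicator_of_notMem (show x ∉ {x | G x < 0} from hneg), sub_zero, abs_mul]
      exact mul_le_of_le_one_left (abs_nonneg _) (abs_le.2 ⟨by linarith, by linarith⟩)
  · rw [indicator_of_notMem (show x ∉ {x | |G x| ≤ m} from hL)]
    rcases lt_abs.1 (not_le.1 hL) with h | h
    · have hr : 0 ≤ r := (abs_nonneg _).trans (hd x hx)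
      rw [stepDown_eq_zero hε (by linarith), indicator_of_notMem]
      · simp
      · rw [mem_ofPred_eq]; linarith
    · have hr : 0 ≤ r := (abs_nonneg _).trans (hd x hx)
      rw [stepDown_eq_one hε (by linarith), indicator_of_mem]
      · simp
      · rw [mem_ofPred_eq]; linarith

/-- The integral over a moving domain `{g s < 0}` changes at the rate `∫ div Y`, up to a small
error, if the flux of `-Y` through the boundary approximates `u` times the rate of change of
`g`. -/
theorem eventually_abs_integral_sub_le {I : Set ℝ} {t : ℝ} {g : ℝ → Plane → ℝ} {a u : Plane → ℝ}
    {X Y : Plane → Plane} {V : Set Plane} {η η' : ℝ}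
    (ht : t ∈ I) (hg : ∀ s ∈ I, ContDiff ℝ 1 (g s))
    (hreg : ∀ x, g t x = 0 → fderiv ℝ (g t) x ≠ 0)
    (ha : Continuous a)
    (hga : ∀ κ > 0, ∀ᶠ s in 𝓝[I] t, ∀ x ∈ closure V,
      |g s x - g t x - (s - t) * a x| ≤ κ * |s - t| ∧ ‖fderiv ℝ (g s) x - fderiv ℝ (g t) x‖ ≤ κ)
    (hVo : IsOpen V) (hV : IsCompact (closure V)) (hu : ContinuousOn u (closure V))
    (hsub : ∀ᶠ s in 𝓝[I] t, {x | g s x < 0} ⊆ V) (hΓ : {x | g t x = 0} ⊆ V)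
    (hη : 0 < η) (hη' : 0 < η') (hX : ContDiff ℝ 1 X) (hXc : HasCompactSupport X)
    (hY : ContDiff ℝ 1 Y) (hX1 : ∀ x, g t x = 0 → 1 < fderiv ℝ (g t) x (X x))
    (hY1 : ∀ x, g t x = 0 → |u x * a x + fderiv ℝ (g t) x (Y x)| < η / 2) :
    ∀ᶠ s in 𝓝[I] t,
      |(∫ x in {x | g s x < 0}, u x) - (∫ x in {x | g t x < 0}, u x)
        - (s - t) * ∫ x in {x | g t x < 0}, divergence Y x|
        ≤ |s - t| * (η * (∫ x, |divergence X x|) + η') := by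
  have hG := hg t ht
  have hcG : Continuous (fderiv ℝ (g t)) := hG.continuous_fderiv one_ne_zero
  have hVm := hVo.measurableSet
  have hsubt : {x | g t x < 0} ⊆ V := hsub.self_of_nhdsWithin ht
  have iY : IntegrableOn (divergence Y) V :=
    ((continuous_divergence hY).continuousOn.integrableOn_compact hV).mono_set subset_closure
  have iu : IntegrableOn u V := (hu.integrableOn_compact hV).mono_set subset_closure
  have hnull : volume {x | g t x = 0} = 0 :=
    volume_zeroLevel_eq_zero hG hreg (hV.isBounded.subset (hΓ.trans subset_closure))
  obtain ⟨m₁, hm₁, hI⟩ := exists_setIntegral_nearLevel_le hG.continuous hVm iY hnull hη'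
  obtain ⟨m₂, hm₂, h₂⟩ := exists_forall_abs_lt_of_eventually hV hG.continuous
    (P := fun x => |u x * a x + fderiv ℝ (g t) x (Y x)| < η / 2 ∧ 1 < fderiv ℝ (g t) x (X x))
    fun x hx hx0 => by
      have c1 : ContinuousWithinAt (fun y => |u y * a y + fderiv ℝ (g t) y (Y y)|)
          (closure V) x :=
        (((hu x hx).mul ha.continuousWithinAt).add
          (hcG.clm_apply hY.continuous).continuousWithinAt).abs
      have c2 : Continuous fun y => fderiv ℝ (g t) y (X y) := hcG.clm_apply hX.continuous
      exact (c1.eventually (gt_mem_nhds (hY1 x hx0))).and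
        (c2.continuousWithinAt.eventually (lt_mem_nhds (hX1 x hx0)))
  obtain ⟨B₁, hB₁⟩ := hV.exists_bound_of_continuousOn hX.continuous.continuousOn
  obtain ⟨B₂, hB₂⟩ := hV.exists_bound_of_continuousOn hY.continuous.continuousOn
  obtain ⟨B₃, hB₃⟩ := hV.exists_bound_of_continuousOn hu
  obtain ⟨B₄, hB₄⟩ := hV.exists_bound_of_continuousOn ha.continuousOn
  set B := max 0 (max (max B₁ B₂) (max B₃ B₄))
  have hB : 0 ≤ B := le_max_left _ _
  have hBX : ∀ x ∈ closure V, ‖X x‖ ≤ B := fun x hx => (hB₁ x hx).trans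
    (((le_max_left _ _).trans (le_max_left _ _)).trans (le_max_right _ _))
  have hBY : ∀ x ∈ closure V, ‖Y x‖ ≤ B := fun x hx => (hB₂ x hx).trans
    (((le_max_right _ _).trans (le_max_left _ _)).trans (le_max_right _ _))
  have hBu : ∀ x ∈ closure V, |u x| ≤ B := fun x hx => (hB₃ x hx).trans
    (((le_max_left _ _).trans (le_max_right _ _)).trans (le_max_right _ _))
  have hBa : ∀ x ∈ closure V, |a x| ≤ B := fun x hx => (hB₄ x hx).trans
    (((le_max_right _ _).trans (le_max_right _ _)).trans (le_max_right _ _))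
  -- Chosen so that `η / 2 + 2κB ≤ η (1 - κB)`: the left side bounds the perturbed flux error per
  -- unit `|τ|`, and `1 - κB` bounds the perturbed transversality from below. The `+ 1` guards
  -- against `B = 0`.
  set κ := η / (2 * (2 + η) * (B + 1)) with hκdef
  have hκ : 0 < κ := by positivity
  have hκB : (2 + η) * (κ * B) ≤ η / 2 := by
    have e : (2 + η) * (κ * (B + 1)) = η / 2 := by
      rw [hκdef]; field_simp
    have : κ * B ≤ κ * (B + 1) := by gcongr; linarith
    rw [← e]
    gcongr
  set m := min m₁ m₂ with hmdef
  have hm : 0 < m := lt_min hm₁ hm₂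
  have hsmall : ∀ᶠ s in 𝓝[I] t, |s - t| * (κ + B) < m / 2 := by
    have hc : Continuous fun s : ℝ => |s - t| * (κ + B) := by fun_prop
    have h0 : |t - t| * (κ + B) < m / 2 := by simpa using hm
    exact mem_nhdsWithin_of_mem_nhds (hc.continuousAt.eventually (gt_mem_nhds h0))
  filter_upwards [hga κ hκ, hsub, hsmall, self_mem_nhdsWithin] with s hs hsV hsm hsI
  set τ := s - t with hτ
  set d : Plane → ℝ := fun x => g s x - g t x with hddef
  have hd : ContDiff ℝ 1 d := (hg s hsI).sub hG
  have hdle : ∀ x ∈ V, |d x| ≤ m / 2 := fun x hx => by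
    have hx' := subset_closure hx
    calc |d x| = |(g s x - g t x - τ * a x) + τ * a x| := by
          congr 1; simp only [hddef]; ring
      _ ≤ κ * |τ| + |τ| * B := by
          refine (abs_add_le _ _).trans (add_le_add (hs x hx').1 ?_)
          rw [abs_mul]
          exact mul_le_mul_of_nonneg_left (hBa x hx') (abs_nonneg _)
      _ = |τ| * (κ + B) := by ring
      _ ≤ m / 2 := hsm.le
  have hDd : ∀ x ∈ V, ‖fderiv ℝ d x‖ ≤ κ := fun x hx => by
    have e : fderiv ℝ d x = fderiv ℝ (g s) x - fderiv ℝ (g t) x :=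
      fderiv_sub (((hg s hsI).differentiable one_ne_zero) x) ((hG.differentiable one_ne_zero) x)
    rw [e]
    exact (hs x (subset_closure hx)).2
  have h0 : ∀ x ∉ V, 0 ≤ g t x := fun x hx => not_lt.1 fun h => hx (hsubt h)
  have h1 : ∀ x ∉ V, 0 ≤ g t x + d x := fun x hx => by
    have e : g t x + d x = g s x := by simp only [hddef]; ring
    rw [e]
    exact not_lt.1 fun h => hx (hsV h)
  have hHV : ∀ θ ∈ Icc (0 : ℝ) 1, ∀ x ∉ V, 0 ≤ g t x + θ * d x := fun θ hθ x hx => by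
    have e : g t x + θ * d x = (1 - θ) * g t x + θ * (g t x + d x) := by ring
    rw [e]
    exact add_nonneg (mul_nonneg (by linarith [hθ.2]) (h0 x hx)) (mul_nonneg hθ.1 (h1 x hx))
  have hθd : ∀ θ ∈ Icc (0 : ℝ) 1, ∀ x ∈ V, |θ * d x| ≤ m / 2 := fun θ hθ x hx => by
    rw [abs_mul, abs_of_nonneg hθ.1]
    exact (mul_le_of_le_one_left (abs_nonneg _) hθ.2).trans (hdle x hx)
  -- The time `s` is fixed and the bound does not depend on `ε`, so the cutoffs may be removed
  -- afterwards. With `ε < m / 4` and `|θ d| ≤ m / 2`, the layer of every interpolated function lies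
  -- in `|g t| < m`.
  have hev : ∀ᶠ ε in 𝓝[>] (0 : ℝ),
      |(∫ x in V, stepDown ε (g s x) * u x) - (∫ x in V, stepDown ε (g t x) * u x)
        - τ * ∫ x in {x | g t x < 0}, divergence Y x|
        ≤ |τ| * (η * (∫ x, |divergence X x|) + η') := by
    filter_upwards [self_mem_nhdsWithin, mem_nhdsWithin_of_mem_nhds (Iio_mem_nhds
      (show 0 < m / 4 by positivity))] with ε (hε : 0 < ε) (hε' : ε < m / 4)
    have e : ∀ x, g s x = g t x + d x := fun x => by simp only [hddef]; ring
    simp_rw [e]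
    refine abs_integral_stepDown_add_sub_le hε hη.le hG hd hV hu hX hXc hY h0 h1 ?_ ?_
    · intro θ hθ x hx hx1 hx2
      have hx' := subset_closure hx
      have hfd : fderiv ℝ (fun y => g t y + θ * d y) x
          = fderiv ℝ (g t) x + θ • fderiv ℝ d x :=
        ((((hG.differentiable one_ne_zero) x).hasFDerivAt).add
          ((((hd.differentiable one_ne_zero) x).hasFDerivAt).const_mul θ)).fderiv
      have hθx := abs_le.1 (hθd θ hθ x hx)
      obtain ⟨p1, p2⟩ := h₂ x hx' (lt_of_lt_of_le (abs_lt.2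
        (⟨by linarith, by linarith⟩ : -m < g t x ∧ g t x < m)) (min_le_right _ _))
      have q0 : |θ| ≤ 1 := by rw [abs_of_nonneg hθ.1]; exact hθ.2
      have qY : |θ * fderiv ℝ d x (Y x)| ≤ κ * B := by
        rw [abs_mul]
        calc |θ| * |fderiv ℝ d x (Y x)| ≤ 1 * (‖fderiv ℝ d x‖ * ‖Y x‖) := by
              gcongr; exact (fderiv ℝ d x).le_opNorm _
          _ ≤ κ * B := by
              rw [one_mul]; gcongr
              · exact hDd x hx
              · exact hBY x hx'
      have qX : |θ * fderiv ℝ d x (X x)| ≤ κ * B := by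
        rw [abs_mul]
        calc |θ| * |fderiv ℝ d x (X x)| ≤ 1 * (‖fderiv ℝ d x‖ * ‖X x‖) := by
              gcongr; exact (fderiv ℝ d x).le_opNorm _
          _ ≤ κ * B := by
              rw [one_mul]; gcongr
              · exact hDd x hx
              · exact hBX x hx'
      have qd : |(d x - τ * a x) * u x| ≤ |τ| * (κ * B) := by
        rw [abs_mul]
        calc |d x - τ * a x| * |u x| ≤ (κ * |τ|) * B := by
              gcongr
              · exact (hs x hx').1
              · exact hBu x hx'
          _ = |τ| * (κ * B) := by ring
      rw [hfd]
      simp only [add_apply, smul_apply, smul_eq_mul]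
      have lower : η / 2 + 2 * (κ * B) ≤ η * (fderiv ℝ (g t) x (X x) + θ * fderiv ℝ d x (X x)) := by
        have h3 : 1 - κ * B ≤ fderiv ℝ (g t) x (X x) + θ * fderiv ℝ d x (X x) := by
          linarith [(abs_le.1 qX).1]
        have h4 := mul_le_mul_of_nonneg_left h3 hη.le
        linarith
      calc |d x * u x + τ * (fderiv ℝ (g t) x (Y x) + θ * fderiv ℝ d x (Y x))|
          = |(d x - τ * a x) * u x + τ * (u x * a x + fderiv ℝ (g t) x (Y x))
              + τ * (θ * fderiv ℝ d x (Y x))| := by congr 1; ring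
        _ ≤ |τ| * (κ * B) + |τ| * (η / 2) + |τ| * (κ * B) := by
            refine (abs_add_three _ _ _).trans (add_le_add (add_le_add qd ?_) ?_)
            · rw [abs_mul]; exact mul_le_mul_of_nonneg_left p1.le (abs_nonneg _)
            · rw [abs_mul]; exact mul_le_mul_of_nonneg_left qY (abs_nonneg _)
        _ = |τ| * (η / 2 + 2 * (κ * B)) := by ring
        _ ≤ |τ| * (η * (fderiv ℝ (g t) x (X x) + θ * fderiv ℝ d x (X x))) :=
            mul_le_mul_of_nonneg_left lower (abs_nonneg _)
        _ = _ := by ring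
    · intro θ hθ
      refine (abs_integral_stepDown_sub_setIntegral_le (m := m₁) (r := m / 2) hε hG.continuous
        (hG.continuous.add (continuous_const.mul hd.continuous)) hVm iY h0 (hHV θ hθ)
        (fun x hx => ?_) ?_).trans hI
      · have e' : (g t x + θ * d x) - g t x = θ * d x := by ring
        exact (congrArg abs e').trans_le (hθd θ hθ x hx)
      · linarith [min_le_left m₁ m₂]
  have t1 := tendsto_setIntegral_stepDown_mul (hg s hsI).continuous hsV hVm iu
  have t2 := tendsto_setIntegral_stepDown_mul hG.continuous hsubt hVm iu
  exact le_of_tendsto ((t1.sub t2).sub_const _).abs hev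

lemma uniqueDiffOn_of_ordConnected {I : Set ℝ} (hI : I.OrdConnected) (hI' : I.Nontrivial) :
    UniqueDiffOn ℝ I := by
  obtain ⟨a, ha, b, hb, hab⟩ := hI'.exists_lt
  refine uniqueDiffOn_convex hI.convex ⟨(a + b) / 2, ?_⟩
  exact interior_mono (hI.out ha hb) (by rw [interior_Icc]; constructor <;> linarith)

/-! ### The level set function of a moving domain -/

namespace IsMovingDomain

variable {I : Set ℝ} {g : ℝ → Plane → ℝ}

lemma contDiff (H : IsMovingDomain I g) {s : ℝ} (hs : s ∈ I) : ContDiff ℝ 1 (g s) := by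
  rw [← contDiffOn_univ]
  exact H.contDiffOn.comp (f := fun x : Plane => (s, x))
    (contDiff_const.prodMk contDiff_id).contDiffOn fun x _ => ⟨hs, mem_univ x⟩

lemma fderiv_ne_zero (H : IsMovingDomain I g) {s : ℝ} (hs : s ∈ I) (x : Plane) (hx : g s x = 0) :
    fderiv ℝ (g s) x ≠ 0 := fun h => H.gradient_ne_zero s hs x hx (by rw [gradient, h, map_zero])

/-- The derivative of the level set function in time and space. -/
noncomputable def spaceTimeDeriv (I : Set ℝ) (g : ℝ → Plane → ℝ) (q : ℝ × Plane) :
    ℝ × Plane →L[ℝ] ℝ :=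
  fderivWithin ℝ (fun q : ℝ × Plane => g q.1 q.2) (I ×ˢ univ) q

lemma continuousOn_spaceTimeDeriv (H : IsMovingDomain I g) (hU : UniqueDiffOn ℝ I) :
    ContinuousOn (spaceTimeDeriv I g) (I ×ˢ univ) :=
  H.contDiffOn.continuousOn_fderivWithin (hU.prod uniqueDiffOn_univ) le_rfl

lemma hasFDerivWithinAt (H : IsMovingDomain I g) {s : ℝ} (hs : s ∈ I) (x : Plane) :
    HasFDerivWithinAt (fun q : ℝ × Plane => g q.1 q.2) (spaceTimeDeriv I g (s, x))
      (I ×ˢ univ) (s, x) :=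
  (H.contDiffOn.differentiableOn one_ne_zero (s, x) ⟨hs, mem_univ x⟩).hasFDerivWithinAt

lemma hasDerivWithinAt_time (H : IsMovingDomain I g) {s : ℝ} (hs : s ∈ I) (x : Plane) :
    HasDerivWithinAt (fun r => g r x) (spaceTimeDeriv I g (s, x) (1, 0)) I s :=
  (H.hasFDerivWithinAt hs x).comp_hasDerivWithinAt s
    (f := fun r : ℝ => (r, x))
    ((hasDerivAt_id s).prodMk (hasDerivAt_const s x)).hasDerivWithinAt
    fun _ hr => ⟨hr, mem_univ x⟩

lemma derivWithin_time (H : IsMovingDomain I g) (hU : UniqueDiffOn ℝ I) {s : ℝ} (hs : s ∈ I)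
    (x : Plane) : derivWithin (fun r => g r x) I s = spaceTimeDeriv I g (s, x) (1, 0) :=
  (H.hasDerivWithinAt_time hs x).derivWithin (hU s hs)

lemma fderiv_space (H : IsMovingDomain I g) {s : ℝ} (hs : s ∈ I) (x : Plane) :
    fderiv ℝ (g s) x = (spaceTimeDeriv I g (s, x)).comp (ContinuousLinearMap.inr ℝ ℝ Plane) := by
  have h := (H.hasFDerivWithinAt hs x).comp x (s := univ) (f := fun y : Plane => (s, y))
    ((hasFDerivAt_const s x).prodMk (hasFDerivAt_id x)).hasFDerivWithinAt
    fun y _ => ⟨hs, mem_univ y⟩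
  rw [hasFDerivWithinAt_univ] at h
  exact h.fderiv

lemma continuous_derivWithin (H : IsMovingDomain I g) (hU : UniqueDiffOn ℝ I) {t : ℝ}
    (ht : t ∈ I) : Continuous fun x => derivWithin (fun r => g r x) I t := by
  simp_rw [H.derivWithin_time hU ht]
  have h : Continuous fun x : Plane => spaceTimeDeriv I g (t, x) :=
    (H.continuousOn_spaceTimeDeriv hU).comp_continuous (by fun_prop) fun x => ⟨ht, mem_univ x⟩
  exact h.clm_apply continuous_const

/-- Joint continuity on `I × K` with `K` compact gives uniformity in `x`. -/
lemma eventually_norm_spaceTimeDeriv_sub_le (H : IsMovingDomain I g) (hU : UniqueDiffOn ℝ I)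
    {t : ℝ} (ht : t ∈ I) {K : Set Plane} (hK : IsCompact K) {κ : ℝ} (hκ : 0 < κ) :
    ∀ᶠ s in 𝓝[I] t, ∀ x ∈ K, ‖spaceTimeDeriv I g (s, x) - spaceTimeDeriv I g (t, x)‖ < κ := by
  obtain ⟨v, hv, hv'⟩ := hK.mem_uniformity_of_prod
    (f := fun s x => spaceTimeDeriv I g (s, x)) (s := I) (q := t)
    ((H.continuousOn_spaceTimeDeriv hU).mono (prod_mono_right (subset_univ K))) ht
    (Metric.dist_mem_uniformity hκ)
  filter_upwards [hv] with s hs x hx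
  rw [← dist_eq_norm]
  exact hv' s hs x hx

/-- Uniform first order expansion of the level set function in time. -/
lemma eventually_expansion (H : IsMovingDomain I g) (hI : I.OrdConnected) (hU : UniqueDiffOn ℝ I)
    {t : ℝ} (ht : t ∈ I) {K : Set Plane} (hK : IsCompact K) {κ : ℝ} (hκ : 0 < κ) :
    ∀ᶠ s in 𝓝[I] t, ∀ x ∈ K,
      |g s x - g t x - (s - t) * derivWithin (fun r => g r x) I t| ≤ κ * |s - t| ∧
      ‖fderiv ℝ (g s) x - fderiv ℝ (g t) x‖ ≤ κ := by
  obtain ⟨δ, hδ, hev⟩ := Metric.mem_nhdsWithin_iff.1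
    (H.eventually_norm_spaceTimeDeriv_sub_le hU ht hK hκ)
  refine Metric.mem_nhdsWithin_iff.2 ⟨δ, hδ, fun s hs x hx => ⟨?_, ?_⟩⟩
  · have hc : Convex ℝ (Metric.ball t δ ∩ I) := (convex_ball t δ).inter hI.convex
    -- With the linear term at `t` subtracted, the time derivative is at most `κ` near `t`,
    -- uniformly on `K`.
    have hmv := hc.norm_image_sub_le_of_norm_hasDerivWithin_le
      (f := fun r => g r x - r * derivWithin (fun r => g r x) I t)
      (f' := fun r => spaceTimeDeriv I g (r, x) (1, 0)
        - 1 * derivWithin (fun r => g r x) I t) (C := κ)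
      (fun r hr => ((H.hasDerivWithinAt_time hr.2 x).mono inter_subset_right).sub
        ((hasDerivAt_id r).mul_const _).hasDerivWithinAt)
      (fun r hr => by
        rw [H.derivWithin_time hU ht, one_mul, ← sub_apply]
        refine ((spaceTimeDeriv I g (r, x) - spaceTimeDeriv I g (t, x)).le_opNorm _).trans ?_
        have h1 : ‖((1 : ℝ), (0 : Plane))‖ = 1 := by simp [Prod.norm_def]
        rw [h1, mul_one]
        exact (hev hr x hx).le)
      ⟨Metric.mem_ball_self hδ, ht⟩ hs
    rw [Real.norm_eq_abs, Real.norm_eq_abs] at hmv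
    refine le_of_eq_of_le (congrArg abs ?_) hmv
    ring
  · rw [H.fderiv_space hs.2, H.fderiv_space ht, ← ContinuousLinearMap.sub_comp]
    refine (ContinuousLinearMap.opNorm_comp_le _ _).trans ?_
    calc _ ≤ ‖spaceTimeDeriv I g (s, x) - spaceTimeDeriv I g (t, x)‖ * 1 := by
          gcongr; exact ContinuousLinearMap.norm_inr_le_one _ _ _
      _ ≤ κ := by rw [mul_one]; exact (hev hs x hx).le

lemma eventually_abs_sub_lt (H : IsMovingDomain I g) {t : ℝ} (ht : t ∈ I) {K : Set Plane}
    (hK : IsCompact K) {κ : ℝ} (hκ : 0 < κ) :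
    ∀ᶠ s in 𝓝[I] t, ∀ x ∈ K, |g s x - g t x| < κ := by
  obtain ⟨v, hv, hv'⟩ := hK.mem_uniformity_of_prod (f := g) (s := I) (q := t)
    (H.contDiffOn.continuousOn.mono (prod_mono_right (subset_univ K))) ht
    (Metric.dist_mem_uniformity hκ)
  filter_upwards [hv] with s hs x hx
  rw [← Real.dist_eq]
  exact hv' s hs x hx

lemma interface_subset_closure (H : IsMovingDomain I g) {t : ℝ} (ht : t ∈ I) :
    {x | g t x = 0} ⊆ closure (inner2 g t) := fun x hx =>
  mem_closure_sublevel (H.contDiff ht) hx (H.fderiv_ne_zero ht x hx)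

/-- The moving domain stays, for a short time, in a given neighbourhood of its closure. -/
lemma eventually_inner2_subset (H : IsMovingDomain I g) {t : ℝ} (ht : t ∈ I) {V : Set Plane}
    (hVo : IsOpen V) (hV : IsCompact (closure V)) (hsub : closure (inner2 g t) ⊆ V) :
    ∀ᶠ s in 𝓝[I] t, {x | g s x < 0} ⊆ V := by
  obtain ⟨x₀, hx₀⟩ := (H.isSimplyConnected t ht).nonempty
  have hx₀' : g t x₀ < 0 := hx₀
  have hfr : IsCompact (frontier V) := hV.of_isClosed_subset isClosed_frontier frontier_subset_closure
  have hG := (H.contDiff ht).continuous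
  have hfrV : ∀ x ∈ frontier V, x ∉ V := fun x hx => by
    rw [hVo.frontier_eq] at hx
    exact hx.2
  -- The zero level lies in the closure of the domain, hence off the frontier of `V`, and so `g t ≥
  -- m > 0` on that compact set.
  obtain ⟨m, hm, hmin⟩ := exists_forall_abs_lt_of_eventually hfr hG (P := fun _ => False)
    fun x hx hx0 => absurd (hsub (H.interface_subset_closure ht hx0)) (hfrV x hx)
  have hpos : ∀ x ∈ frontier V, m ≤ g t x := fun x hx => by
    have h1 : m ≤ |g t x| := not_lt.1 fun h => hmin x hx h
    have h2 : 0 ≤ g t x := not_lt.1 fun h => hfrV x hx (hsub (subset_closure h))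
    rwa [abs_of_nonneg h2] at h1
  filter_upwards [H.eventually_abs_sub_lt ht hfr hm,
    H.eventually_abs_sub_lt ht (isCompact_singleton (x := x₀)) (neg_pos.2 hx₀'),
    self_mem_nhdsWithin] with s h1 h2 hsI
  have hpre : IsPreconnected {x | g s x < 0} :=
    (H.isSimplyConnected s hsI).isPathConnected.isConnected.isPreconnected
  have hx₀s : g s x₀ < 0 := by
    have := (abs_lt.1 (h2 x₀ rfl)).2
    linarith
  -- The connected domain at time `s` still contains `x₀` and avoids the frontier of `V`, so it
  -- cannot leave `V`.
  refine hpre.subset_left_of_subset_union (v := (closure V)ᶜ) hVo isClosed_closure.isOpen_compl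
    (disjoint_compl_right.mono_left subset_closure) (fun x (hx : g s x < 0) => ?_)
    ⟨x₀, hx₀s, hsub (subset_closure hx₀)⟩
  by_contra hcon
  rw [mem_union, not_or, notMem_compl_iff] at hcon
  have hxf : x ∈ frontier V := by
    rw [hVo.frontier_eq]
    exact ⟨hcon.2, hcon.1⟩
  have := (abs_lt.1 (h1 x hxf)).1
  linarith [hpos x hxf]

end IsMovingDomain

/-! ### Moment dynamics -/

/-- Constants are weakly harmonic. Subtracting the interface pressure yields a solution that
vanishes on `Γ`, which removes the boundary term `q ∂u/∂n` from Green's identity. -/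
lemma IsPressure.poisson_sub_const {D : Set Plane} {c χ : ℝ} {S : Sources} {p : Plane → ℝ}
    (H : IsPressure D c χ S p) (b : ℝ) (φ : Plane → ℝ) (hφ : ContDiff ℝ ∞ φ)
    (hc : HasCompactSupport φ) (hs : tsupport φ ⊆ D) :
    ∫ x in D, (p x - b) * (Δ φ) x = c * (∫ x in D, φ x) + χ * S.integral φ := by
  have hcont : Continuous (Δ φ) := by
    have e : Δ φ = divergence (gradient φ) := funext (laplacian_eq_divergence_gradient hφ)
    rw [e]
    exact continuous_divergence (contDiff_gradient hφ)
  have hz : ∀ x ∉ tsupport φ, (Δ φ) x = 0 := fun x hx => by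
    rw [laplacian_eq_divergence_gradient hφ]
    exact divergence_eq_zero_of_notMem_tsupport fun h => hx (tsupport_gradient_subset φ h)
  have hcs : HasCompactSupport (Δ φ) := HasCompactSupport.intro hc hz
  have i0 : IntegrableOn (fun x => p x * (Δ φ) x) (tsupport φ) :=
    (H.locallyIntegrableOn.integrableOn_compact_subset hs hc).mul_continuousOn
      hcont.continuousOn hc
  have i1 : Integrable fun x => p x * (Δ φ) x :=
    i0.integrable_of_forall_notMem_eq_zero fun x hx => by rw [hz x hx, mul_zero]
  have i2 : Integrable fun x => b * (Δ φ) x :=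
    (hcont.integrable_of_hasCompactSupport hcs).const_mul b
  have e0 : ∫ x in D, b * (Δ φ) x = 0 := by
    rw [integral_const_mul, setIntegral_eq_integral_of_forall_compl_eq_zero fun x hx =>
      hz x fun h => hx (hs h), integral_laplacian_eq_zero hφ hc, mul_zero]
  simp_rw [sub_mul]
  rw [integral_sub i1.integrableOn i2.integrableOn, e0, sub_zero, H.poisson φ hφ hc hs]

lemma Sources.LieIn.isCompact_cut {S : Sources} {D : Set Plane} (H : S.LieIn D)
    (hD : Bornology.IsBounded D) : IsCompact S.cut :=
  Metric.isCompact_of_isClosed_isBounded H.isClosed_cut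
    (hD.subset (subset_union_left.trans H.support_subset))

lemma Sources.LieIn.isCompact_support {S : Sources} {D : Set Plane} (H : S.LieIn D)
    (hD : Bornology.IsBounded D) : IsCompact S.support :=
  (H.isCompact_cut hD).union S.points.finite_toSet.isCompact

lemma Sources.LieIn.integrableOn_mul_density {S : Sources} {D : Set Plane} (H : S.LieIn D)
    (hD : Bornology.IsBounded D) {u : Plane → ℝ} (hu : ContinuousOn u D) :
    IntegrableOn (fun x => u x * S.density x) S.cut μH[1] := by
  have hK := H.isCompact_cut hD
  have h := H.integrableOn S.cut hK
  rw [inter_self] at h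
  exact h.continuousOn_mul (hu.mono (subset_union_left.trans H.support_subset)) hK

namespace IsMuskatSolution

variable {I : Set ℝ} {ν₁ ν₂ χ₁ χ₂ : ℝ} {h : ℝ → ℝ} {S₁ S₂ : ℝ → Sources}
  {g p₁ p₂ : ℝ → Plane → ℝ} {f : ℝ → ℝ}

/-- The kinematic condition with the factor `-1 / |∇g|` cleared, so that neither the unit normal nor
`v_n` appears later. -/
lemma mobility_mul_fderivWithin (H : IsMuskatSolution I ν₁ ν₂ χ₁ χ₂ h S₁ S₂ g p₁ p₂ f) {t : ℝ}
    (ht : t ∈ I) {x : Plane} (hx : g t x = 0) :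
    mobility ν₂ h t * fderivWithin ℝ (p₂ t) (closure (inner2 g t)) x (gradient (g t) x)
      = derivWithin (fun s => g s x) I t := by
  have hne : ‖gradient (g t) x‖ ≠ 0 :=
    norm_ne_zero_iff.2 (H.movingDomain.gradient_ne_zero t ht x hx)
  have hk := H.kinematic₂ t ht x hx
  rw [boundaryDeriv, normal, normalVelocity, map_smul, smul_eq_mul] at hk
  field_simp at hk
  linarith

/-- The rate of change of the integral of a harmonic function over the inner fluid. -/
theorem hasDerivWithinAt_integral (H : IsMuskatSolution I ν₁ ν₂ χ₁ χ₂ h S₁ S₂ g p₁ p₂ f)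
    (hI : I.OrdConnected) (hI' : I.Nontrivial) {t : ℝ} (ht : t ∈ I) {U : Set Plane}
    (hUo : IsOpen U) (hU : closure (inner2 g t) ⊆ U) {u : Plane → ℝ} (hu : HarmonicOnNhd u U) :
    HasDerivWithinAt (fun s => ∫ x in inner2 g s, u x)
      (-mobility ν₂ h t * (1 / mobility ν₂ h t * (derivWithin h I t / h t)
        * (∫ x in inner2 g t, u x) + χ₂ * (S₂ t).integral u)) I t := by
  have hD := uniqueDiffOn_of_ordConnected hI hI'
  have M := H.movingDomain
  have hG := M.contDiff ht
  have hreg := M.fderiv_ne_zero ht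
  have hb := M.isBounded t ht
  have hΓcl := M.interface_subset_closure ht
  set a : Plane → ℝ := fun x => derivWithin (fun s => g s x) I t with hadef
  have ha : Continuous a := M.continuous_derivWithin hD ht
  obtain ⟨V, hVo, hΩV, hVU, hV⟩ :=
    exists_open_between_and_isCompact_closure hb.isCompact_closure hUo hU
  have huc : ContinuousOn u (closure V) := hu.continuousOn.mono hVU
  obtain ⟨X, hX, hXc, -, hX1⟩ :=
    exists_transversal_field hG hreg hVo hV (hΓcl.trans hΩV)
  obtain ⟨N, hNo, hN, hpN⟩ := (H.pressure₂ t ht).contDiffOn_boundary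
  have hΓN : {x | g t x = 0} ⊆ N := by
    rw [← frontier_sublevel hG hreg]; exact hN
  set C := ∫ x, |divergence X x| with hCdef
  have hC : 0 ≤ C := integral_nonneg fun x => abs_nonneg _
  rw [hasDerivWithinAt_iff_isLittleO, Asymptotics.isLittleO_iff]
  intro ε hε
  -- The error `η C` is paid twice, once for the flux and once for transport; together they use half
  -- of `ε`, and the layer error `ε / 2` uses the rest.
  set η := ε / (4 * (C + 1)) with hηdef
  have hη : 0 < η := by positivity
  have hηC : 2 * (η * C) ≤ ε / 2 := by
    have e : 2 * (η * (C + 1)) = ε / 2 := by rw [hηdef]; field_simp; norm_num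
    rw [← e]
    gcongr
    linarith
  obtain ⟨Y, hY, hY1⟩ := exists_field_with_flux (a := fun x => u x * a x) hG hreg
    (fun x hx => ((hu.continuousOn.continuousAt
      (hUo.mem_nhds (hU (hΓcl hx)))).mul ha.continuousAt)) (half_pos hη)
  have hΩU : inner2 g t ⊆ U := subset_closure.trans hU
  have flux := abs_flux_sub_integral_divergence_le (q := fun x => p₂ t x - f t) (u := u) (X := X)
    (Y := Y) (a := a) (k := mobility ν₂ h t) hG hreg hb hNo hΓN
    ((H.pressure₂ t ht).poisson_sub_const (f t)) (hpN.sub contDiffOn_const)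
    (fun x hx => by rw [H.pressure_interface t ht x hx, sub_self])
    (fun x hx => by
      rw [fderivWithin_sub_const]
      exact H.mobility_mul_fderivWithin ht hx)
    (fun x hx => hu x (hU hx))
    ((H.sources₂ t ht).integrableOn_mul_density hb (hu.continuousOn.mono hΩU))
    (H.sources₂ t ht).isClosed_cut.measurableSet
    ((H.sources₂ t ht).isCompact_support hb) (H.sources₂ t ht).support_subset hη.le hX hXc hY hX1
    (fun x hx => (hY1 x hx).trans (half_lt_self hη))
  have trans := eventually_abs_integral_sub_le ht (fun s hs => M.contDiff hs) hreg ha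
    (fun κ hκ => M.eventually_expansion hI hD ht hV hκ) hVo hV huc
    (M.eventually_inner2_subset ht hVo hV hΩV) (hΓcl.trans hΩV) hη (half_pos hε) hX hXc hY hX1 hY1
  filter_upwards [trans] with s hs
  change |(∫ x in {x | g s x < 0}, u x) - (∫ x in {x | g t x < 0}, u x)
    - (s - t) * _| ≤ ε * |s - t|
  set R := -mobility ν₂ h t * (1 / mobility ν₂ h t * (derivWithin h I t / h t)
        * (∫ x in inner2 g t, u x) + χ₂ * (S₂ t).integral u) with hR
  set J := ∫ x in {x | g t x < 0}, divergence Y x with hJ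
  have hflux : |R - J| ≤ η * C := flux
  calc _ = |((∫ x in {x | g s x < 0}, u x) - (∫ x in {x | g t x < 0}, u x) - (s - t) * J)
        + (s - t) * (-(R - J))| := by congr 1; ring
    _ ≤ |s - t| * (η * C + ε / 2) + |s - t| * (η * C) := by
        refine (abs_add_le _ _).trans (add_le_add hs ?_)
        rw [abs_mul, abs_neg]
        exact mul_le_mul_of_nonneg_left hflux (abs_nonneg _)
    _ = |s - t| * (2 * (η * C) + ε / 2) := by ring
    _ ≤ |s - t| * ε := by
        refine mul_le_mul_of_nonneg_left ?_ (abs_nonneg _)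
        linarith
    _ = ε * |s - t| := mul_comm _ _

/-- The moment dynamics equation. -/
theorem hasDerivWithinAt_moment (H : IsMuskatSolution I ν₁ ν₂ χ₁ χ₂ h S₁ S₂ g p₁ p₂ f)
    (hI : I.OrdConnected) (hI' : I.Nontrivial) {t : ℝ} (ht : t ∈ I) {U : Set Plane}
    (hUo : IsOpen U) (hU : closure (inner2 g t) ⊆ U) {u : Plane → ℝ} (hu : HarmonicOnNhd u U) :
    HasDerivWithinAt (fun s => h s * ∫ x in inner2 g s, u x)
      (-χ₂ * mobility ν₂ h t * h t * (S₂ t).integral u) I t := by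
  have hh := H.gap_pos t ht
  have hk : mobility ν₂ h t ≠ 0 := by
    have := H.viscosity₂_pos
    unfold mobility
    positivity
  -- In the product rule `ḣ ∫ u` cancels against `h · k₂ · (1/k₂)(ḣ/h) ∫ u`.
  refine ((H.gap_differentiable t ht).hasDerivWithinAt.mul
    (H.hasDerivWithinAt_integral hI hI' ht hUo hU hu)).congr_deriv ?_
  field_simp
  ring

theorem moment_eq_of_no_sources (H : IsMuskatSolution I ν₁ ν₂ χ₁ χ₂ h S₁ S₂ g p₁ p₂ f)
    (hI : I.OrdConnected) (hI' : I.Nontrivial) (hχ : χ₂ = 0) {U : Set Plane}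
    (hUo : IsOpen U) (hU : ∀ t ∈ I, closure (inner2 g t) ⊆ U) {u : Plane → ℝ}
    (hu : HarmonicOnNhd u U) {s t : ℝ} (hs : s ∈ I) (ht : t ∈ I) :
    h s * ∫ x in inner2 g s, u x = h t * ∫ x in inner2 g t, u x := by
  have hd := hI.convex.norm_image_sub_le_of_norm_hasDerivWithin_le (C := 0)
    (fun r hr => H.hasDerivWithinAt_moment hI hI' hr hUo (hU r hr) hu)
    (fun r _ => by rw [hχ]; simp) ht hs
  rw [zero_mul] at hd
  exact sub_eq_zero.1 (norm_le_zero_iff.1 hd)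

theorem hasDerivWithinAt_volume (H : IsMuskatSolution I ν₁ ν₂ χ₁ χ₂ h S₁ S₂ g p₁ p₂ f)
    (hI : I.OrdConnected) (hI' : I.Nontrivial) {t : ℝ} (ht : t ∈ I) :
    HasDerivWithinAt (fun s => volume.real (inner2 g s) * h s)
      (-χ₂ * mobility ν₂ h t * h t * (S₂ t).integral 1) I t := by
  have hd := H.hasDerivWithinAt_moment hI hI' ht isOpen_univ (subset_univ _)
    (harmonicOnNhd_const (1 : ℝ))
  simp only [setIntegral_const, smul_eq_mul, mul_one] at hd
  simp only [mul_comm (h _)] at hd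
  exact hd

end IsMuskatSolution

end HeleShaw

/-! ### Moment dynamics and conservation of volume -/

open HeleShaw in
theorem mainTheorem4 (I : Set ℝ) (hI : I.OrdConnected) (hI' : I.Nontrivial)
    (ν₁ ν₂ χ₁ χ₂ : ℝ) (h : ℝ → ℝ) (S₁ S₂ : ℝ → Sources) (g p₁ p₂ : ℝ → Plane → ℝ) (f : ℝ → ℝ)
    (H : IsMuskatSolution I ν₁ ν₂ χ₁ χ₂ h S₁ S₂ g p₁ p₂ f) :
    -- the moment dynamics equation
    (∀ t ∈ I, ∀ U : Set Plane, IsOpen U → closure (inner2 g t) ⊆ U →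
      ∀ u : Plane → ℝ, HarmonicOnNhd u U →
        IntegrableOn u (inner2 g t) ∧
        IntegrableOn (fun x => u x * (S₂ t).density x) (S₂ t).cut μH[1] ∧
        HasDerivWithinAt (fun s => h s * ∫ x in inner2 g s, u x)
          (-χ₂ * mobility ν₂ h t * h t * (S₂ t).integral u) I t) ∧
    -- conserved quantities in the absence of sinks and sources
    (χ₂ = 0 → ∀ U : Set Plane, IsOpen U → (∀ t ∈ I, closure (inner2 g t) ⊆ U) →
      ∀ u : Plane → ℝ, HarmonicOnNhd u U → ∀ s ∈ I, ∀ t ∈ I,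
        h s * ∫ x in inner2 g s, u x = h t * ∫ x in inner2 g t, u x) ∧
    -- the choice `u ≡ 1`: evolution and conservation of volume
    (∀ t ∈ I, HasDerivWithinAt (fun s => volume.real (inner2 g s) * h s)
      (-χ₂ * mobility ν₂ h t * h t * (S₂ t).integral 1) I t) ∧
    (χ₂ = 0 → ∀ s ∈ I, ∀ t ∈ I,
      volume.real (inner2 g s) * h s = volume.real (inner2 g t) * h t) ∧
    (χ₂ = 1 → ((∀ s ∈ I, ∀ t ∈ I,
        volume.real (inner2 g s) * h s = volume.real (inner2 g t) * h t) ↔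
      ∀ t ∈ I, (S₂ t).integral 1 = 0)) := by
  have const_of_deriv : (∀ t ∈ I, -χ₂ * mobility ν₂ h t * h t * (S₂ t).integral 1 = 0) →
      ∀ s ∈ I, ∀ t ∈ I,
        volume.real (inner2 g s) * h s = volume.real (inner2 g t) * h t := by
    intro hz s hs t ht
    have hd := hI.convex.norm_image_sub_le_of_norm_hasDerivWithin_le (C := 0)
      (fun r hr => H.hasDerivWithinAt_volume hI hI' hr)
      (fun r hr => by rw [hz r hr, norm_zero]) ht hs
    rw [zero_mul] at hd
    exact sub_eq_zero.1 (norm_le_zero_iff.1 hd)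
  refine ⟨fun t ht U hUo hU u hu => ⟨?_, ?_, H.hasDerivWithinAt_moment hI hI' ht hUo hU hu⟩,
    fun hχ U hUo hU u hu s hs t ht => H.moment_eq_of_no_sources hI hI' hχ hUo hU hu hs ht,
    fun t ht => H.hasDerivWithinAt_volume hI hI' ht,
    fun hχ => const_of_deriv fun t _ => by rw [hχ]; simp, fun hχ => ⟨fun hc t ht => ?_, fun hz => ?_⟩⟩
  · exact ((hu.continuousOn.mono hU).integrableOn_compact
      (H.movingDomain.isBounded t ht).isCompact_closure).mono_set subset_closure
  · exact (H.sources₂ t ht).integrableOn_mul_density (H.movingDomain.isBounded t ht)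
      (hu.continuousOn.mono (subset_closure.trans hU))
  · have h1 := H.hasDerivWithinAt_volume hI hI' ht
    have h2 : HasDerivWithinAt (fun s => volume.real (inner2 g s) * h s) 0 I t :=
      (hasDerivWithinAt_const t I (volume.real (inner2 g t) * h t)).congr
        (fun s hs => hc s hs t ht) rfl
    -- Derivatives within a nondegenerate interval are unique, also at its end points, so constant
    -- volume forces the right-hand side to vanish; the factor `k₂ h` is positive.
    have h3 := (uniqueDiffOn_of_ordConnected hI hI' t ht).eq_deriv I h1 h2
    have hh := H.gap_pos t ht
    have hk : 0 < mobility ν₂ h t := by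
      have := H.viscosity₂_pos
      unfold mobility
      positivity
    rw [hχ] at h3
    refine (mul_eq_zero.1 h3).resolve_left ?_
    have := mul_pos hk hh
    linarith
  · exact const_of_deriv fun t ht => by rw [hz t ht, mul_zero]
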